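/- Let $E$ be a real Banach lattice with topological dual $E'$, and let $K$ be a bounded subset of $E$. Its solid hull is $\mathrm{Sol}(K)=\{y\in E : |y|\le |x| \text{ for some } x\in K\}$. A sequence $(x_n)$ in $E$ is disjoint if $|x_m|\wedge|x_n|=0$ whenever $m\ne n$. A bounded linear operator $T$ from $E$ into a Banach space is called Dunford–Pettis if $\|Tx_n\|\to 0$ for every weakly null sequence $(x_n)$ in $E$, and almost Dunford–Pettis if $\|Tx_n\|\to0$ for every disjoint weakly null sequence $(x_n)$ in $E$. A series $\sum_n x_n'$ in $E'$ is weakly unconditionally Cauchy if $\sum_n |x''(x_n')|<\infty$ for every $x''\in E''$. The following statements are equivalent: 1. $K$ is a reciprocal Dunford–Pettis set, i.e. $T(K)$ is relatively weakly compact for every Banach space $Y$ and every Dunford–Pettis operator $T:E\to Y$. 2. $K$ is a V$^*$-set, i.e. $\sup_{x\in K}|x_n'(x)|\to0$ for every weakly unconditionally Cauchy series $\sum_n x_n'$ in $E'$. 3. $K$ is disjointly weakly compact, i.e. every disjoint sequence in $\mathrm{Sol}(K)$ is weakly null. 4. $T(K)$ is relatively weakly compact for every Banach space $X$ and every almost Dunford–Pettis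 operator $T:E\to X$. -/

import Mathlib

open Filter Topology

universe u v w

namespace BanachLatticeSets

section BanachSpace

variable {X : Type u} [NormedAddCommGroup X] [NormedSpace ℝ X]

/-- The sequence `x` converges to `0` in the weak topology of `X`. -/
def WeaklyNull (x : ℕ → X) : Prop :=
  Tendsto (fun n => toWeakSpace ℝ X (x n)) atTop (𝓝 0)

/-- The weak closure of `S` is weakly compact. -/
def RelativelyWeaklyCompact (S : Set X) : Prop :=
  IsCompact (closure (toWeakSpace ℝ X '' S))

/-- The series `∑ x n` is weakly unconditionally Cauchy: `∑ |φ (x n)|` converges for every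
continuous linear functional `φ` on `X`. -/
def WeaklyUnconditionallyCauchy (x : ℕ → X) : Prop :=
  ∀ φ : StrongDual ℝ X, Summable (fun n => |φ (x n)|)

/-- V*-sets: bounded sets on which the terms of every weakly unconditionally Cauchy series in the
dual tend uniformly to zero. The supremum is taken in `[0, ∞]`. -/
def IsVStarSet (K : Set X) : Prop :=
  Bornology.IsBounded K ∧
    ∀ f : ℕ → StrongDual ℝ X, WeaklyUnconditionallyCauchy f →
      Tendsto (fun n => ⨆ x ∈ K, ‖f n x‖ₑ) atTop (𝓝 0)

/-- Dunford-Pettis operators: bounded operators sending weakly null sequences to norm null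
sequences. -/
def IsDunfordPettis {Y : Type v} [NormedAddCommGroup Y] [NormedSpace ℝ Y] (T : X →L[ℝ] Y) : Prop :=
  ∀ x : ℕ → X, WeaklyNull x → Tendsto (fun n => ‖T (x n)‖) atTop (𝓝 0)

/-- Reciprocal Dunford-Pettis sets: bounded sets whose image under every Dunford-Pettis operator
into a Banach space is relatively weakly compact. -/
def IsReciprocalDunfordPettisSet (K : Set X) : Prop :=
  Bornology.IsBounded K ∧
    ∀ (Y : Type v) [NormedAddCommGroup Y] [NormedSpace ℝ Y] [CompleteSpace Y] (T : X →L[ℝ] Y),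
      IsDunfordPettis T → RelativelyWeaklyCompact (T '' K)

end BanachSpace

section BanachLattice

variable {E : Type u} [NormedAddCommGroup E] [NormedSpace ℝ E] [Lattice E]

/-- The terms of the sequence are pairwise disjoint: `|x m| ∧ |x n| = 0` for `m ≠ n`. -/
def DisjointSeq (x : ℕ → E) : Prop :=
  ∀ m n : ℕ, m ≠ n → |x m| ⊓ |x n| = 0

/-- Disjointly weakly compact sets: bounded sets such that every disjoint sequence in the solid
hull is weakly null. -/
def IsDisjointlyWeaklyCompact (K : Set E) : Prop :=
  Bornology.IsBounded K ∧
    ∀ x : ℕ → E, (∀ n, x n ∈ LatticeOrderedAddCommGroup.solidClosure K) →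
      DisjointSeq x → WeaklyNull x

/-- Almost Dunford-Pettis operators: bounded operators sending disjoint weakly null sequences to
norm null sequences. -/
def IsAlmostDunfordPettis {Y : Type v} [NormedAddCommGroup Y] [NormedSpace ℝ Y]
    (T : E →L[ℝ] Y) : Prop :=
  ∀ x : ℕ → E, DisjointSeq x → WeaklyNull x → Tendsto (fun n => ‖T (x n)‖) atTop (𝓝 0)

end BanachLattice

end BanachLatticeSets

set_option linter.unusedSectionVars false

/-! The implications proved are 1 → 2 → 3 → 4, 3 → 1 and 4 → 2.

From 1 or 4 to 2: a weakly unconditionally Cauchy series in the dual is an operator into `ℓ¹`. By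
the Schur property it is Dunford–Pettis, so it maps `K` to a relatively weakly compact, hence
relatively norm compact, subset of `ℓ¹`, and the coordinates tend to zero uniformly on such a set
(`isVStarSet_of_forall_lp_one`).

From 2 to 3: for a disjoint sequence `x n` in the solid hull and a functional `f`, the parts of the
modulus of `f` carried by the ideals of the `x n` have bounded sum. Hahn–Banach picks a functional
below each part, and these form a weakly unconditionally Cauchy series that dominates `f (x n)` on
`K`.

From 3 to 4, and to 1 because Dunford–Pettis operators are almost Dunford–Pettis: up to a small
error under `T`, the set `K` lies in an order interval (`exists_forall_norm_posPart_sub_le`). If `T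
'' K` were not relatively weakly compact, there would be functionals `f m` and points `T (x n)` with
`f m (T (x n)) > θ` for `m ≤ n` and `= 0` for `n < m`. Convex combinations `y`, `z` of tails of the
truncated sequence can be made close for a weighted sum `μ` of the moduli of the `f j ∘ T`, while
some `f k ∘ T` still separates them by `θ / 2`. So `w = |y - z|` is small for each modulus but not
uniformly. This contradicts `exists_forall_le_of_le_inv_pow`, an equicontinuity statement on order
intervals that rests on the vanishing of the lattice seminorm of `T` along disjoint sequences. -/

namespace BanachLatticeSets

/-! ### Vector lattice inequalities, Riesz decomposition and disjointification. -/

section VectorLattice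

variable {E : Type*} [NormedAddCommGroup E] [Lattice E] [IsOrderedAddMonoid E]

theorem inf_add_le_inf_add_inf {a b c : E} (ha : 0 ≤ a) (hb : 0 ≤ b) (hc : 0 ≤ c) :
    a ⊓ (b + c) ≤ a ⊓ b + a ⊓ c := by
  rw [inf_add, add_inf, add_inf]
  refine le_inf (le_inf ?_ ?_) (le_inf ?_ ?_)
  · exact inf_le_left.trans (le_add_of_nonneg_left ha)
  · exact inf_le_left.trans (le_add_of_nonneg_right hc)
  · exact inf_le_left.trans (le_add_of_nonneg_left hb)
  · exact inf_le_right

theorem inf_sum_le_sum_inf {ι : Type*} {a : E} (ha : 0 ≤ a) (s : Finset ι) (b : ι → E)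
    (hb : ∀ i ∈ s, 0 ≤ b i) : a ⊓ ∑ i ∈ s, b i ≤ ∑ i ∈ s, a ⊓ b i := by
  classical
  induction s using Finset.induction_on with
  | empty => simp
  | insert i s hi ih =>
    rw [Finset.sum_insert hi, Finset.sum_insert hi]
    refine (inf_add_le_inf_add_inf ha (hb i (by simp))
      (Finset.sum_nonneg fun j hj => hb j (by simp [hj]))).trans ?_
    gcongr
    exact ih fun j hj => hb j (by simp [hj])

/-- The Riesz decomposition property. -/
theorem exists_decomposition_of_abs_le_add {a b y : E} (ha : 0 ≤ a) (hb : 0 ≤ b)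
    (h : |y| ≤ a + b) :
    ∃ y₁ y₂ : E, y = y₁ + y₂ ∧ |y₁| ≤ a ∧ |y₂| ≤ b ∧ |y₁| ≤ |y| ∧ |y₂| ≤ |y| := by
  obtain ⟨h1, h2⟩ := abs_le'.1 h
  have hyy : y ≤ |y| := le_abs_self y
  have hny : -y ≤ |y| := neg_le_abs y
  have h0 : 0 ≤ |y| := abs_nonneg y
  -- The first summand is `y` truncated to `[-a, a]`.
  refine ⟨(y ⊓ a) ⊔ (-a), y - (y ⊓ a) ⊔ (-a), by abel, ?_, ?_, ?_, ?_⟩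
  · refine abs_le'.2 ⟨sup_le inf_le_right ((neg_nonpos.2 ha).trans ha), ?_⟩
    exact neg_le.1 le_sup_right
  · refine abs_le'.2 ⟨?_, ?_⟩
    · refine sub_le_comm.1 (le_sup_of_le_left (le_inf (sub_le_self _ hb) ?_))
      exact sub_le_iff_le_add.2 h1
    · rw [neg_sub]
      refine sub_le_iff_le_add.2 (sup_le (inf_le_left.trans (le_add_of_nonneg_left hb)) ?_)
      linear_combination (norm := exact le_of_eq (by module)) h2
  · refine abs_le'.2 ⟨sup_le (inf_le_left.trans hyy) ((neg_nonpos.2 ha).trans h0), ?_⟩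
    exact neg_le.1 (le_sup_of_le_left (le_inf (neg_le.1 hny) ((neg_nonpos.2 h0).trans ha)))
  · refine abs_le'.2 ⟨?_, ?_⟩
    · refine sub_le_comm.1 (le_sup_of_le_left (le_inf (sub_le_self _ h0) ?_))
      exact (sub_nonpos.2 hyy).trans ha
    · rw [neg_sub]
      refine sub_le_iff_le_add.2 (sup_le (inf_le_left.trans (le_add_of_nonneg_left h0)) ?_)
      refine (neg_nonpos.2 ha).trans ?_
      linear_combination (norm := exact le_of_eq (by module)) hny

theorem abs_inf_eq_zero_of_le {a b c d : E} (hac : |a| ≤ |c|) (hbd : |b| ≤ |d|)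
    (h : |c| ⊓ |d| = 0) : |a| ⊓ |b| = 0 :=
  le_antisymm ((inf_le_inf hac hbd).trans h.le) (le_inf (abs_nonneg _) (abs_nonneg _))

theorem abs_sum_le_sum_abs {ι : Type*} (s : Finset ι) (x : ι → E) :
    |∑ i ∈ s, x i| ≤ ∑ i ∈ s, |x i| := by
  classical
  induction s using Finset.induction_on with
  | empty => simp
  | insert i s hi ih =>
    rw [Finset.sum_insert hi, Finset.sum_insert hi]
    exact (abs_add_le _ _).trans (by gcongr)

theorem posPart_inf_neg_posPart (a : E) : a⁺ ⊓ (-a)⁺ = 0 := by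
  rw [posPart_neg]
  exact posPart_inf_negPart_eq_zero a

theorem le_posPart_sub_add (a c : E) : a ≤ (a - c)⁺ + c := by
  have := le_posPart (a - c)
  rwa [sub_le_iff_le_add] at this

theorem eq_posPart_sub_add_inf (a c : E) : a = (a - c)⁺ + a ⊓ c := by
  rw [inf_eq_sub_posPart_sub]; abel

variable [NormedSpace ℝ E]

theorem DisjointSeq.mono {x y : ℕ → E} (hx : DisjointSeq x) (h : ∀ n, |y n| ≤ |x n|) :
    DisjointSeq y := fun m n hmn => abs_inf_eq_zero_of_le (h m) (h n) (hx m n hmn)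

/-- Finite sums of disjoint elements dominated by `a` are dominated by `a`. -/
theorem DisjointSeq.sum_abs_le {x : ℕ → E} (hx : DisjointSeq x) {a : E} (ha : 0 ≤ a)
    (h : ∀ n, |x n| ≤ a) (s : Finset ℕ) : ∑ n ∈ s, |x n| ≤ a := by
  classical
  induction s using Finset.induction_on with
  | empty => simpa
  | insert i s hi ih =>
    rw [Finset.sum_insert hi, ← inf_add_sup]
    have h0 : |x i| ⊓ ∑ n ∈ s, |x n| ≤ 0 := by
      refine (inf_sum_le_sum_inf (abs_nonneg _) s _ fun _ _ => abs_nonneg _).trans ?_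
      refine Finset.sum_nonpos fun n hn => (hx i n ?_).le
      rintro rfl
      exact hi hn
    calc _ ≤ 0 + a := add_le_add h0 (sup_le (h i) ih)
      _ = a := zero_add a

variable [IsOrderedModule ℝ E]

theorem abs_smul' (c : ℝ) (x : E) : |c • x| = |c| • |x| := by
  have key : ∀ (d : ℝ), 0 ≤ d → ∀ y : E, |d • y| ≤ d • |y| := by
    intro d hd y
    refine abs_le'.2 ⟨smul_le_smul_of_nonneg_left (le_abs_self y) hd, ?_⟩
    rw [← smul_neg]
    exact smul_le_smul_of_nonneg_left (neg_le_abs y) hd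
  have key2 : ∀ (d : ℝ), 0 ≤ d → ∀ y : E, |d • y| = d • |y| := by
    intro d hd y
    refine le_antisymm (key d hd y) ?_
    rcases hd.eq_or_lt with rfl | hd
    · simp
    · have := smul_le_smul_of_nonneg_left (key d⁻¹ (by positivity) (d • y)) hd.le
      rwa [smul_smul, smul_smul, mul_inv_cancel₀ hd.ne', inv_mul_cancel₀ hd.ne', one_smul,
        one_smul] at this
  rcases le_total 0 c with hc | hc
  · rw [key2 c hc, abs_of_nonneg hc]
  · rw [← abs_neg, ← neg_smul, key2 (-c) (by linarith), abs_of_nonpos hc]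

theorem smul_inf_le {c : ℝ} (hc : 1 ≤ c) {a b : E} (ha : 0 ≤ a) : a ⊓ c • b ≤ c • (a ⊓ b) := by
  have h1 : c⁻¹ • (a ⊓ c • b) ≤ a ⊓ b := by
    refine le_inf ?_ ?_
    · calc c⁻¹ • (a ⊓ c • b) ≤ c⁻¹ • a := smul_le_smul_of_nonneg_left inf_le_left (by positivity)
        _ ≤ (1 : ℝ) • a := smul_le_smul_of_nonneg_right (inv_le_one_of_one_le₀ hc) ha
        _ = a := one_smul _ _
    · calc c⁻¹ • (a ⊓ c • b) ≤ c⁻¹ • c • b := smul_le_smul_of_nonneg_left inf_le_right (by positivity)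
        _ = b := by rw [smul_smul, inv_mul_cancel₀ (by positivity), one_smul]
  have := smul_le_smul_of_nonneg_left h1 (by positivity : 0 ≤ c)
  rwa [smul_smul, mul_inv_cancel₀ (by positivity), one_smul] at this

/-- A standard disjointification of a sequence of positive elements. -/
theorem disjointSeq_disjointify {x : ℕ → E} {z : E} (hx : ∀ n, 0 ≤ x n)
    (hz : ∀ n, ((2 : ℝ) ^ n)⁻¹ • x n ≤ z) :
    DisjointSeq fun n =>
      (x n - (4 : ℝ) ^ n • ∑ i ∈ Finset.range n, x i - ((2 : ℝ) ^ n)⁻¹ • z)⁺ := by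
  have hz0 : 0 ≤ z := (smul_nonneg (by positivity) (hx 0)).trans (hz 0)
  have key : ∀ m n : ℕ, n < m →
      (x m - (4 : ℝ) ^ m • ∑ i ∈ Finset.range m, x i - ((2 : ℝ) ^ m)⁻¹ • z)⁺ ⊓
      (x n - (4 : ℝ) ^ n • ∑ i ∈ Finset.range n, x i - ((2 : ℝ) ^ n)⁻¹ • z)⁺ = 0 := by
    intro m n hnm
    refine le_antisymm ?_ (le_inf (posPart_nonneg _) (posPart_nonneg _))
    -- With this `c`, the subtracted terms dominate `c • x n` and `c⁻¹ • x m` respectively. The two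
    -- positive parts are then below those of `x m - c • x n` and `x n - c⁻¹ • x m`, which are
    -- negative multiples of each other.
    set c : ℝ := 2 ^ m * 2 ^ n with hc
    have hc1 : 1 ≤ c := one_le_mul_of_one_le_of_one_le (one_le_pow₀ (by norm_num))
      (one_le_pow₀ (by norm_num))
    have hc4 : c ≤ 4 ^ m := by
      rw [hc, show (4 : ℝ) = 2 * 2 by norm_num, mul_pow]
      gcongr
      norm_num
    have h1 : (x m - (4 : ℝ) ^ m • ∑ i ∈ Finset.range m, x i - ((2 : ℝ) ^ m)⁻¹ • z) ≤
        x m - c • x n := by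
      refine (sub_le_self _ (smul_nonneg (by positivity) hz0)).trans ?_
      refine sub_le_sub_left ?_ _
      calc c • x n ≤ (4 : ℝ) ^ m • x n := smul_le_smul_of_nonneg_right hc4 (hx n)
        _ ≤ _ := smul_le_smul_of_nonneg_left
          (Finset.single_le_sum (f := x) (fun i _ => hx i) (Finset.mem_range.2 hnm)) (by positivity)
    have h2 : (x n - (4 : ℝ) ^ n • ∑ i ∈ Finset.range n, x i - ((2 : ℝ) ^ n)⁻¹ • z) ≤
        x n - c⁻¹ • x m := by
      calc _ ≤ x n - ((2 : ℝ) ^ n)⁻¹ • z := sub_le_sub_right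
            (sub_le_self _ (smul_nonneg (by positivity) (Finset.sum_nonneg fun i _ => hx i))) _
        _ ≤ _ := by
          refine sub_le_sub_left ?_ _
          rw [hc, mul_inv, mul_comm, mul_smul]
          exact smul_le_smul_of_nonneg_left (hz m) (by positivity)
    have h3 : c⁻¹ • (x m - c • x n) = -(x n - c⁻¹ • x m) := by
      rw [smul_sub, smul_smul, inv_mul_cancel₀ (by positivity), one_smul, neg_sub]
    calc _ ≤ (x m - c • x n)⁺ ⊓ (x n - c⁻¹ • x m)⁺ :=
          inf_le_inf (posPart_mono h1) (posPart_mono h2)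
      _ = (x n - c⁻¹ • x m)⁺ ⊓ c • (-(x n - c⁻¹ • x m))⁺ := by
          rw [inf_comm, ← h3]
          congr 1
          rw [posPart_def, posPart_def]
          refine le_antisymm (sup_le ?_ (smul_nonneg (by positivity) le_sup_right)) ?_
          · have := smul_le_smul_of_nonneg_left
              (le_sup_left : c⁻¹ • (x m - c • x n) ≤ c⁻¹ • (x m - c • x n) ⊔ 0)
              (by positivity : 0 ≤ c)
            rwa [smul_smul, mul_inv_cancel₀ (by positivity), one_smul] at this
          · have : c⁻¹ • (x m - c • x n) ⊔ 0 ≤ c⁻¹ • ((x m - c • x n) ⊔ 0) :=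
              sup_le (smul_le_smul_of_nonneg_left le_sup_left (by positivity))
                (smul_nonneg (by positivity) le_sup_right)
            have := smul_le_smul_of_nonneg_left this (by positivity : 0 ≤ c)
            rwa [smul_smul, mul_inv_cancel₀ (by positivity), one_smul] at this
      _ ≤ c • ((x n - c⁻¹ • x m)⁺ ⊓ (-(x n - c⁻¹ • x m))⁺) := smul_inf_le hc1 (posPart_nonneg _)
      _ = 0 := by rw [posPart_inf_neg_posPart, smul_zero]
  intro m n hmn
  simp only [abs_of_nonneg (posPart_nonneg _)]
  rcases lt_or_gt_of_ne hmn with h | h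
  · rw [inf_comm]; exact key n m h
  · exact key m n h

end VectorLattice

/-! ### Moduli of operators and functionals as lattice seminorms. -/

section SolidSeminorm

variable {E : Type*} [NormedAddCommGroup E] [NormedSpace ℝ E] [Lattice E] [IsOrderedAddMonoid E]
  [IsOrderedModule ℝ E] [HasSolidNorm E] {Y : Type*} [NormedAddCommGroup Y] [NormedSpace ℝ Y]

theorem bddAbove_norm_apply (T : E →L[ℝ] Y) (I : Submodule ℝ E) (x : E) :
    BddAbove (Set.range fun y : {y : E // y ∈ I ∧ |y| ≤ |x|} => ‖T y‖) := by
  refine ⟨‖T‖ * ‖x‖, ?_⟩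
  rintro _ ⟨⟨y, -, hy⟩, rfl⟩
  exact (T.le_opNorm y).trans (by gcongr; exact HasSolidNorm.solid hy)

instance (I : Submodule ℝ E) (x : E) : Nonempty {y : E // y ∈ I ∧ |y| ≤ |x|} :=
  ⟨⟨0, I.zero_mem, by simp⟩⟩

/-- The lattice seminorm `x ↦ sup {‖T y‖ : |y| ≤ |x|, y ∈ I}` for a solid subspace `I`. -/
noncomputable def solidSeminorm (T : E →L[ℝ] Y) (I : Submodule ℝ E)
    (hI : LatticeOrderedAddCommGroup.IsSolid (I : Set E)) : Seminorm ℝ E :=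
  Seminorm.of (fun x => ⨆ y : {y : E // y ∈ I ∧ |y| ≤ |x|}, ‖T y‖)
    (by
      intro a b
      refine ciSup_le ?_
      rintro ⟨y, hyI, hy⟩
      obtain ⟨y₁, y₂, rfl, h1, h2, h3, h4⟩ := exists_decomposition_of_abs_le_add (abs_nonneg a)
        (abs_nonneg b) (hy.trans (abs_add_le a b))
      simp only [map_add]
      exact (norm_add_le _ _).trans (add_le_add
        (le_ciSup (bddAbove_norm_apply T I a) ⟨y₁, hI hyI h3, h1⟩)
        (le_ciSup (bddAbove_norm_apply T I b) ⟨y₂, hI hyI h4, h2⟩)))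
    (by
      have key : ∀ (c : ℝ) (x : E), ⨆ y : {y : E // y ∈ I ∧ |y| ≤ |x|}, ‖c • T y‖ ≤
          ⨆ y : {y : E // y ∈ I ∧ |y| ≤ |c • x|}, ‖T y‖ := by
        intro c x
        refine ciSup_le ?_
        rintro ⟨y, hyI, hy⟩
        rw [← map_smul]
        refine le_ciSup (bddAbove_norm_apply T I (c • x)) ⟨c • y, I.smul_mem c hyI, ?_⟩
        rw [abs_smul', abs_smul']
        exact smul_le_smul_of_nonneg_left hy (abs_nonneg c)
      have key' : ∀ (c : ℝ) (x : E), ‖c‖ * ⨆ y : {y : E // y ∈ I ∧ |y| ≤ |x|}, ‖T y‖ ≤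
          ⨆ y : {y : E // y ∈ I ∧ |y| ≤ |c • x|}, ‖T y‖ := by
        intro c x
        refine le_trans ?_ (key c x)
        rw [Real.mul_iSup_of_nonneg (norm_nonneg c)]
        simp only [norm_smul, le_refl]
      intro c x
      refine le_antisymm ?_ (key' c x)
      rcases eq_or_ne c 0 with rfl | hc
      · simp only [norm_zero, zero_mul]
        refine ciSup_le ?_
        rintro ⟨y, -, hy⟩
        rw [zero_smul, abs_zero] at hy
        have : y = 0 := by simpa using HasSolidNorm.solid (hy.trans (abs_nonneg (0 : E)))
        simp [this]
      -- The reverse inequality is `key'` for the inverse scalar.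
      · have := key' c⁻¹ (c • x)
        rw [smul_smul, inv_mul_cancel₀ hc, one_smul, norm_inv] at this
        rwa [inv_mul_le_iff₀ (norm_pos_iff.2 hc)] at this)

variable {T : E →L[ℝ] Y} {I : Submodule ℝ E} {hI : LatticeOrderedAddCommGroup.IsSolid (I : Set E)}

theorem norm_le_solidSeminorm {x y : E} (hy : y ∈ I) (h : |y| ≤ |x|) :
    ‖T y‖ ≤ solidSeminorm T I hI x :=
  le_ciSup (bddAbove_norm_apply T I x) ⟨y, hy, h⟩

theorem solidSeminorm_le {x : E} {r : ℝ} (h : ∀ y ∈ I, |y| ≤ |x| → ‖T y‖ ≤ r) :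
    solidSeminorm T I hI x ≤ r :=
  ciSup_le fun y => h y y.2.1 y.2.2

theorem exists_lt_of_lt_solidSeminorm {x : E} {r : ℝ} (h : r < solidSeminorm T I hI x) :
    ∃ y ∈ I, |y| ≤ |x| ∧ r < ‖T y‖ := by
  obtain ⟨⟨y, hy, hyx⟩, hr⟩ := exists_lt_of_lt_ciSup h
  exact ⟨y, hy, hyx, hr⟩

theorem solidSeminorm_mono {x y : E} (h : |x| ≤ |y|) :
    solidSeminorm T I hI x ≤ solidSeminorm T I hI y :=
  solidSeminorm_le fun _ hz hzx => norm_le_solidSeminorm hz (hzx.trans h)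

theorem solidSeminorm_le_norm (x : E) : solidSeminorm T I hI x ≤ ‖T‖ * ‖x‖ :=
  solidSeminorm_le fun y _ hy => (T.le_opNorm y).trans (by gcongr; exact HasSolidNorm.solid hy)

theorem isSolid_top : LatticeOrderedAddCommGroup.IsSolid ((⊤ : Submodule ℝ E) : Set E) :=
  fun _ _ _ _ => trivial

/-- The lattice seminorm `x ↦ sup {‖T y‖ : |y| ≤ |x|}`. -/
noncomputable abbrev latticeSeminorm (T : E →L[ℝ] Y) : Seminorm ℝ E :=
  solidSeminorm T ⊤ isSolid_top

theorem norm_le_latticeSeminorm {x y : E} (h : |y| ≤ |x|) : ‖T y‖ ≤ latticeSeminorm T x :=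
  norm_le_solidSeminorm trivial h

/-- The modulus of a functional is additive on the positive cone. -/
theorem latticeSeminorm_add_of_nonneg (g : StrongDual ℝ E) {a b : E} (ha : 0 ≤ a) (hb : 0 ≤ b) :
    latticeSeminorm g (a + b) = latticeSeminorm g a + latticeSeminorm g b := by
  refine le_antisymm (map_add_le_add _ _ _) ?_
  refine le_of_forall_pos_le_add fun ε hε => ?_
  have aux : ∀ x : E, ∃ y : E, |y| ≤ |x| ∧ latticeSeminorm g x - ε / 2 < g y := by
    intro x
    obtain ⟨y, -, hy, h⟩ := exists_lt_of_lt_solidSeminorm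
      (show latticeSeminorm g x - ε / 2 < solidSeminorm g ⊤ isSolid_top x by linarith)
    rcases abs_cases (g y) with h' | h'
    · exact ⟨y, hy, by rwa [Real.norm_eq_abs, h'.1] at h⟩
    · exact ⟨-y, by rwa [abs_neg], by rwa [Real.norm_eq_abs, h'.1, ← map_neg] at h⟩
  obtain ⟨y, hy, hy'⟩ := aux a
  obtain ⟨z, hz, hz'⟩ := aux b
  have : ‖g (y + z)‖ ≤ latticeSeminorm g (a + b) := by
    refine norm_le_latticeSeminorm ((abs_add_le _ _).trans ?_)
    rw [abs_of_nonneg (add_nonneg ha hb)]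
    rw [abs_of_nonneg ha] at hy
    rw [abs_of_nonneg hb] at hz
    exact add_le_add hy hz
  have h2 : g y + g z ≤ ‖g (y + z)‖ := (map_add g y z).symm.le.trans (Real.le_norm_self _)
  linarith

end SolidSeminorm

/-! ### Disjoint sequences, functionals, and the implication from V*-sets to disjointly weakly
compact sets. -/

section DisjointFunctionals

variable {E : Type*} [NormedAddCommGroup E] [NormedSpace ℝ E] [Lattice E] [IsOrderedAddMonoid E]
  [IsOrderedModule ℝ E] [HasSolidNorm E]

theorem weaklyNull_iff_forall_dual {X : Type*} [NormedAddCommGroup X] [NormedSpace ℝ X] {x : ℕ → X} :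
    WeaklyNull x ↔ ∀ f : StrongDual ℝ X, Tendsto (fun n => f (x n)) atTop (𝓝 0) := by
  have hB : Function.Injective (topDualPairing ℝ X).flip := by
    intro a b hab
    exact (SeparatingDual.eq_iff_forall_dual_eq (R := ℝ)).2 fun f => LinearMap.congr_fun hab f
  refine (WeakBilin.tendsto_iff_forall_eval_tendsto _ hB).trans (forall_congr' fun f => ?_)
  have h0 : (topDualPairing ℝ X).flip (0 : X) f = 0 := map_zero f
  change Tendsto (fun n => f (x n)) atTop (𝓝 ((topDualPairing ℝ X).flip (0 : X) f)) ↔ _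
  rw [h0]

/-- Absorbing the signs of the `f (x n)` turns the sum into the value of `f` at one vector, still
dominated by `|a|` by disjointness. -/
theorem DisjointSeq.sum_abs_apply_le {x : ℕ → E} (hx : DisjointSeq x) {a : E}
    (h : ∀ n, |x n| ≤ |a|) (f : StrongDual ℝ E) (s : Finset ℕ) :
    ∑ n ∈ s, |f (x n)| ≤ ‖f‖ * ‖a‖ := by
  have h1 : ∑ n ∈ s, |f (x n)| = f (∑ n ∈ s, (SignType.sign (f (x n)) : ℝ) • x n) := by
    rw [map_sum]
    refine Finset.sum_congr rfl fun n _ => ?_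
    rw [map_smul, smul_eq_mul, sign_mul_self]
  rw [h1]
  refine (Real.le_norm_self _).trans ((f.le_opNorm _).trans ?_)
  gcongr
  refine HasSolidNorm.solid ((abs_sum_le_sum_abs _ _).trans ?_)
  refine le_trans (Finset.sum_le_sum fun n _ => ?_) (hx.sum_abs_le (abs_nonneg a) h s)
  rw [abs_smul']
  refine (smul_le_smul_of_nonneg_right ?_ (abs_nonneg _)).trans (one_smul ℝ _).le
  rcases lt_trichotomy (f (x n)) 0 with h | h | h <;> simp [h]

theorem DisjointSeq.weaklyNull_of_abs_le {x : ℕ → E} (hx : DisjointSeq x) {a : E}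
    (h : ∀ n, |x n| ≤ |a|) : WeaklyNull x := by
  refine weaklyNull_iff_forall_dual.2 fun f => ?_
  refine (tendsto_zero_iff_abs_tendsto_zero _).2 (Summable.tendsto_atTop_zero ?_)
  exact summable_of_sum_range_le (fun _ => abs_nonneg _)
    fun n => hx.sum_abs_apply_le h f (Finset.range n)

/-- The principal ideal generated by an element of a vector lattice. -/
def principalIdeal (a : E) : Submodule ℝ E where
  carrier := {y | ∃ c : ℝ, 0 ≤ c ∧ |y| ≤ c • |a|}
  zero_mem' := ⟨0, le_rfl, by simp⟩
  add_mem' := by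
    rintro y z ⟨c, hc, hy⟩ ⟨d, hd, hz⟩
    refine ⟨c + d, by positivity, ?_⟩
    rw [add_smul]
    exact (abs_add_le _ _).trans (add_le_add hy hz)
  smul_mem' := by
    rintro r y ⟨c, hc, hy⟩
    refine ⟨|r| * c, by positivity, ?_⟩
    rw [abs_smul', mul_smul]
    exact smul_le_smul_of_nonneg_left hy (abs_nonneg r)

theorem isSolid_principalIdeal (a : E) :
    LatticeOrderedAddCommGroup.IsSolid (principalIdeal a : Set E) := by
  rintro y ⟨c, hc, hy⟩ z hz
  exact ⟨c, hc, hz.trans hy⟩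

theorem inf_eq_zero_of_mem_principalIdeal {a b y z : E} (h : |a| ⊓ |b| = 0)
    (hy : y ∈ principalIdeal a) (hz : z ∈ principalIdeal b) : |y| ⊓ |z| = 0 := by
  obtain ⟨c, hc, hy⟩ := hy
  obtain ⟨d, hd, hz⟩ := hz
  refine le_antisymm ?_ (le_inf (abs_nonneg _) (abs_nonneg _))
  set r := max 1 (max c d)
  have h1 : |y| ≤ r • |a| := hy.trans (smul_le_smul_of_nonneg_right (by simp [r]) (abs_nonneg a))
  have h2 : |z| ≤ r • |b| := hz.trans (smul_le_smul_of_nonneg_right (by simp [r]) (abs_nonneg b))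
  have hr : 1 ≤ r := le_max_left _ _
  calc |y| ⊓ |z| ≤ (r • |a|) ⊓ (r • |b|) := inf_le_inf h1 h2
    _ ≤ r • ((r • |a|) ⊓ |b|) := smul_inf_le hr (smul_nonneg (by positivity) (abs_nonneg a))
    _ ≤ r • r • (|b| ⊓ |a|) := by
        refine smul_le_smul_of_nonneg_left ?_ (by positivity)
        rw [inf_comm]
        exact smul_inf_le hr (abs_nonneg b)
    _ = 0 := by rw [inf_comm, h, smul_zero, smul_zero]

/-- Nearly optimal elements for the separate seminorms lie in disjoint ideals, so they form a
disjoint sequence dominated by `|a|`, to which `DisjointSeq.sum_abs_apply_le` applies. -/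
theorem sum_solidSeminorm_principalIdeal_le {x : ℕ → E} (hx : DisjointSeq x)
    (f : StrongDual ℝ E) (a : E) (N : ℕ) :
    ∑ n ∈ Finset.range N, solidSeminorm f (principalIdeal (x n)) (isSolid_principalIdeal _) a ≤
      ‖f‖ * ‖a‖ := by
  refine le_of_forall_pos_le_add fun ε hε => ?_
  have hδ : 0 < ε / (N + 1) := by positivity
  have := fun n => exists_lt_of_lt_solidSeminorm (sub_lt_self
    (solidSeminorm f (principalIdeal (x n)) (isSolid_principalIdeal _) a) hδ)
  choose z hz hza hlt using this
  have hdis : DisjointSeq z := fun m n hmn =>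
    inf_eq_zero_of_mem_principalIdeal (hx m n hmn) (hz m) (hz n)
  have h1 := hdis.sum_abs_apply_le hza f (Finset.range N)
  calc _ ≤ ∑ n ∈ Finset.range N, (|f (z n)| + ε / (N + 1)) :=
        Finset.sum_le_sum fun n _ => by linarith [hlt n, Real.norm_eq_abs (f (z n))]
    _ = ∑ n ∈ Finset.range N, |f (z n)| + N * (ε / (N + 1)) := by
        rw [Finset.sum_add_distrib]; simp
    _ ≤ ‖f‖ * ‖a‖ + ε := by
        refine add_le_add h1 ?_
        rw [mul_div_assoc', div_le_iff₀ (by positivity)]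
        nlinarith

theorem _root_.Seminorm.exists_dual_eq_and_abs_le {X : Type*} [AddCommGroup X] [Module ℝ X]
    (p : Seminorm ℝ X) (y : X) : ∃ g : Module.Dual ℝ X, g y = p y ∧ ∀ x, |g x| ≤ p x := by
  rcases eq_or_ne y 0 with rfl | hy
  · exact ⟨0, by simp, by simp⟩
  · obtain ⟨g, hg, hle⟩ := Module.Dual.exists_extension_of_le_seminorm_real
      (LinearPMap.mkSpanSingleton (K := ℝ) (σ := RingHom.id ℝ) y (p y) hy).domain
      (LinearPMap.mkSpanSingleton y (p y) hy).toFun (p := p) (by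
        rintro ⟨x, hx⟩
        obtain ⟨c, rfl⟩ := Submodule.mem_span_singleton.1 hx
        refine (LinearPMap.mkSpanSingleton'_apply _ _ _ c hx).le.trans ?_
        rw [map_smul_eq_mul, RingHom.id_apply, smul_eq_mul]
        gcongr
        exact Real.le_norm_self c)
    refine ⟨g, ?_, hle⟩
    exact (hg ⟨y, Submodule.mem_span_singleton_self y⟩).trans
      (LinearPMap.mkSpanSingleton_apply ℝ ℝ hy (p y))

theorem weaklyUnconditionallyCauchy_of_sum_abs_le {X : Type*} [NormedAddCommGroup X]
    [NormedSpace ℝ X] {h : ℕ → StrongDual ℝ X} {C : ℝ} (hC : 0 ≤ C)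
    (hh : ∀ x N, ∑ n ∈ Finset.range N, |h n x| ≤ C * ‖x‖) : WeaklyUnconditionallyCauchy h := by
  intro φ
  refine summable_of_sum_range_le (c := ‖φ‖ * C) (fun _ => abs_nonneg _) fun N => ?_
  have h1 : ∑ n ∈ Finset.range N, |φ (h n)| =
      φ (∑ n ∈ Finset.range N, (SignType.sign (φ (h n)) : ℝ) • h n) := by
    rw [map_sum]
    refine Finset.sum_congr rfl fun n _ => ?_
    rw [map_smul, smul_eq_mul, sign_mul_self]
  rw [h1]
  refine (Real.le_norm_self _).trans ((φ.le_opNorm _).trans ?_)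
  gcongr
  refine ContinuousLinearMap.opNorm_le_bound _ hC fun x => ?_
  rw [sum_apply]
  refine (norm_sum_le _ _).trans (le_trans (Finset.sum_le_sum fun n _ => ?_) (hh x N))
  rw [smul_apply, norm_smul, ← Real.norm_eq_abs]
  refine mul_le_of_le_one_left (norm_nonneg _) ?_
  rcases lt_trichotomy (φ (h n)) 0 with h' | h' | h' <;> simp [h']

/-- The Hahn–Banach functional `h n` attains `p n` at `y n ∈ K`, and `p n (y n)` bounds `|f (x n)|`
because `x n` itself lies in its ideal and `|x n| ≤ |y n|`. -/
theorem IsVStarSet.isDisjointlyWeaklyCompact {K : Set E} (hK : IsVStarSet K) :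
    IsDisjointlyWeaklyCompact K := by
  refine ⟨hK.1, fun x hxK hx => weaklyNull_iff_forall_dual.2 fun f => ?_⟩
  choose y hyK hxy using hxK
  let p : ℕ → Seminorm ℝ E := fun n =>
    solidSeminorm f (principalIdeal (x n)) (isSolid_principalIdeal _)
  have hp : ∀ n a, p n a ≤ ‖f‖ * ‖a‖ := fun n a => solidSeminorm_le_norm a
  choose g hgy hgp using fun n => (p n).exists_dual_eq_and_abs_le (y n)
  let h : ℕ → StrongDual ℝ E := fun n =>
    (g n).mkContinuous ‖f‖ fun a => (hgp n a).trans (hp n a)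
  have hwuc : WeaklyUnconditionallyCauchy h := by
    refine weaklyUnconditionallyCauchy_of_sum_abs_le (norm_nonneg f) fun a N => ?_
    exact (Finset.sum_le_sum fun n _ => hgp n a).trans (sum_solidSeminorm_principalIdeal_le hx f a N)
  have hlim := hK.2 h hwuc
  have hle : ∀ n, ‖f (x n)‖ₑ ≤ ⨆ a ∈ K, ‖h n a‖ₑ := by
    intro n
    refine le_trans ?_ (le_iSup₂ (f := fun a (_ : a ∈ K) => ‖h n a‖ₑ) (y n) (hyK n))
    refine enorm_le_iff_norm_le.2 ?_
    refine (norm_le_solidSeminorm (hI := isSolid_principalIdeal (x n))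
      ⟨1, zero_le_one, by simp⟩ (hxy n)).trans ?_
    exact (hgy n).symm.le.trans (Real.le_norm_self _)
  have := tendsto_of_tendsto_of_tendsto_of_le_of_le tendsto_const_nhds hlim (fun _ => zero_le) hle
  exact tendsto_zero_iff_enorm_tendsto_zero.2 this

end DisjointFunctionals

/-! ### A separation criterion for the failure of relative weak compactness. -/

section WeakCompactness

variable {X : Type*} [NormedAddCommGroup X] [NormedSpace ℝ X]

/-- A functional whose distance to the span of finitely many functionals exceeds `r` exceeds `r`
on the intersection of the unit ball with their kernels. -/
theorem exists_lt_apply_of_lt_norm_sub {φ : StrongDual ℝ X} {r : ℝ} (hr : 0 ≤ r)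
    (s : Finset (StrongDual ℝ X)) (hφ : ∀ ψ ∈ Submodule.span ℝ (s : Set (StrongDual ℝ X)),
      r < ‖φ - ψ‖) : ∃ x : X, ‖x‖ ≤ 1 ∧ (∀ ψ ∈ s, ψ x = 0) ∧ r < φ x := by
  by_contra! H
  let L : s → X →ₗ[ℝ] ℝ := fun ψ => ((ψ : StrongDual ℝ X) : X →ₗ[ℝ] ℝ)
  let M : Submodule ℝ X := ⨅ i, LinearMap.ker (L i)
  have hM : ∀ x ∈ M, ∀ ψ ∈ s, ψ x = 0 := fun x hx ψ hψ => (Submodule.mem_iInf _).1 hx ⟨ψ, hψ⟩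
  have hφM : ‖φ.comp M.subtypeL‖ ≤ r := by
    refine ContinuousLinearMap.opNorm_le_of_unit_norm hr ?_
    rintro ⟨x, hx⟩ hx1
    have hx1' : ‖x‖ = 1 := hx1
    have h1 := H x hx1'.le (hM x hx)
    have h2 := H (-x) (by rw [norm_neg, hx1']) (hM (-x) (M.neg_mem hx))
    rw [map_neg] at h2
    exact abs_le'.2 ⟨h1, h2⟩
  -- `φ - ψ` vanishes on the common kernel `M`, so it lies in the span, at distance `‖ψ‖ ≤ r` from
  -- `φ`.
  obtain ⟨ψ, hψ, hψn⟩ := exists_extension_norm_eq M (φ.comp M.subtypeL)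
  have hker : (⨅ i, LinearMap.ker (L i)) ≤
      LinearMap.ker ((φ - ψ : StrongDual ℝ X) : X →ₗ[ℝ] ℝ) := by
    intro x hx
    exact sub_eq_zero.2 (hψ ⟨x, hx⟩).symm
  have hspan := mem_span_of_iInf_ker_le_ker hker
  have hle : Submodule.span ℝ (Set.range L) ≤
      (Submodule.span ℝ (s : Set (StrongDual ℝ X))).map (ContinuousLinearMap.coeLM ℝ) := by
    rw [Submodule.span_le]
    rintro _ ⟨i, rfl⟩
    exact ⟨i, Submodule.subset_span i.2, rfl⟩
  obtain ⟨χ, hχ, hχ'⟩ := hle hspan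
  have h1 := hφ χ hχ
  rw [show χ = φ - ψ from ContinuousLinearMap.coe_injective hχ', sub_sub_cancel, hψn] at h1
  linarith

/-- A bounded set which is not relatively weakly compact contains a sequence separated from its
tails by functionals vanishing on the earlier terms. -/
theorem exists_seq_of_not_relativelyWeaklyCompact [CompleteSpace X] {S : Set X}
    (hb : Bornology.IsBounded S) (hS : ¬ RelativelyWeaklyCompact S) :
    ∃ θ > 0, ∃ (f : ℕ → StrongDual ℝ X) (x : ℕ → X), (∀ n, ‖f n‖ ≤ 1) ∧ (∀ n, x n ∈ S) ∧
      (∀ m n, m ≤ n → θ < f m (x n)) ∧ ∀ m n, m < n → f n (x m) = 0 := by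
  have hb' : Bornology.IsBounded (toWeakSpace ℝ X ⁻¹' (toWeakSpace ℝ X '' S)) := by
    rwa [Set.preimage_image_eq _ (toWeakSpace ℝ X).injective]
  have hnot := mt (NormedSpace.isCompact_closure_of_isBounded ℝ X (toWeakSpace ℝ X '' S) hb') hS
  obtain ⟨φ, hφ, hφr⟩ := Set.not_subset.1 hnot
  set φ' : StrongDual ℝ (StrongDual ℝ X) := WeakDual.toStrongDual φ with hφ'
  obtain ⟨r, hr, hdist⟩ : ∃ r > 0, ∀ x : X,
      r < ‖φ' - NormedSpace.inclusionInDoubleDual ℝ X x‖ := by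
    have hclosed :=
      (NormedSpace.inclusionInDoubleDualLi ℝ (E := X)).isometry.isUniformInducing.isComplete_range.isClosed
    have hmem : φ' ∉ Set.range (NormedSpace.inclusionInDoubleDual ℝ X) := by
      rintro ⟨x, hx⟩
      refine hφr ⟨toWeakSpace ℝ X x, ?_⟩
      exact WeakDual.toStrongDual_inj _ _ |>.1 hx
    have hpos := (hclosed.notMem_iff_infDist_pos (Set.range_nonempty _)).1 hmem
    refine ⟨_, half_pos hpos, fun x => (half_lt_self hpos).trans_le ?_⟩
    exact (Metric.infDist_le_dist_of_mem (Set.mem_range_self x)).trans (dist_eq_norm _ _).le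
  -- Pairs (functional, point) are chosen inductively. The functional kills the earlier points and
  -- is large at `φ'`, which is possible since `φ'` is far from `X`. The point then comes from
  -- approximating the weak* limit `φ'` on all functionals chosen so far.
  obtain ⟨F, hF, hF'⟩ := exists_seq_of_forall_finset_exists
    (fun p : StrongDual ℝ X × X => ‖p.1‖ ≤ 1 ∧ p.2 ∈ S ∧ r < φ' p.1 ∧ r < p.1 p.2)
    (fun p q => q.1 p.2 = 0 ∧ r < p.1 q.2) (by
      intro s hs
      classical
      obtain ⟨f, hf1, hf0, hfr⟩ := exists_lt_apply_of_lt_norm_sub (φ := φ') hr.le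
        (s.image fun p => NormedSpace.inclusionInDoubleDual ℝ X p.2) (by
          intro ψ hψ
          have hle : Submodule.span ℝ (((s.image fun p =>
              NormedSpace.inclusionInDoubleDual ℝ X p.2) : Finset _) : Set _) ≤
              LinearMap.range (NormedSpace.inclusionInDoubleDual ℝ X).toLinearMap := by
            rw [Submodule.span_le, Finset.coe_image]
            rintro _ ⟨p, -, rfl⟩
            exact ⟨p.2, rfl⟩
          obtain ⟨x, rfl⟩ := hle hψ
          exact hdist x)
      let t : Finset (StrongDual ℝ X) := insert f (s.image Prod.fst)
      have ht : ∀ g ∈ t, r < φ' g := by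
        intro g hg
        rcases Finset.mem_insert.1 hg with rfl | hg
        · exact hfr
        · obtain ⟨p, hp, rfl⟩ := Finset.mem_image.1 hg
          exact (hs p hp).2.2.1
      have hopen : IsOpen (⋂ g ∈ t, {ψ : WeakDual ℝ (StrongDual ℝ X) | r < ψ g}) :=
        isOpen_biInter_finset fun g _ =>
          isOpen_lt continuous_const (WeakDual.eval_continuous g)
      obtain ⟨_, hψ, _, ⟨x, hx, rfl⟩, rfl⟩ := mem_closure_iff.1 hφ _ hopen (Set.mem_iInter₂.2 ht)
      have hx' : ∀ g ∈ t, r < g x := Set.mem_iInter₂.1 hψ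
      refine ⟨(f, x), ⟨hf1, hx, hfr, hx' f (by simp [t])⟩, fun p hp => ⟨?_, ?_⟩⟩
      · exact hf0 _ (Finset.mem_image_of_mem (fun p : StrongDual ℝ X × X =>
          NormedSpace.inclusionInDoubleDual ℝ X p.2) hp)
      · exact hx' _ (Finset.mem_insert_of_mem (Finset.mem_image_of_mem _ hp)))
  refine ⟨r, hr, fun n => (F n).1, fun n => (F n).2, fun n => (hF n).1, fun n => (hF n).2.1,
    fun m n hmn => ?_, fun m n hmn => (hF' m n hmn).1⟩
  rcases hmn.eq_or_lt with rfl | hmn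
  · exact (hF m).2.2.2
  · exact (hF' m n hmn).2

end WeakCompactness

/-! ### Seminorms vanishing along disjoint sequences of an order interval. -/

section LatticeSeminorm

variable {E : Type*} [NormedAddCommGroup E] [NormedSpace ℝ E] [Lattice E] [IsOrderedAddMonoid E]
  [IsOrderedModule ℝ E]

/-- Lattice seminorms. -/
def IsLatticeSeminorm (q : Seminorm ℝ E) : Prop := ∀ ⦃x y : E⦄, |x| ≤ |y| → q x ≤ q y

theorem IsLatticeSeminorm.mono {q : Seminorm ℝ E} (hq : IsLatticeSeminorm q) {x y : E}
    (hx : 0 ≤ x) (hxy : x ≤ y) : q x ≤ q y :=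
  hq (by rwa [abs_of_nonneg hx, abs_of_nonneg (hx.trans hxy)])

/-- Disjoint sequences in the order interval `[0, a]` are null sequences for `q`. -/
def DisjointNullOn (q : Seminorm ℝ E) (a : E) : Prop :=
  ∀ z : ℕ → E, (∀ n, 0 ≤ z n) → (∀ n, z n ≤ a) → DisjointSeq z →
    Tendsto (fun n => q (z n)) atTop (𝓝 0)

theorem seminorm_sum_le {ι : Type*} (q : Seminorm ℝ E) (s : Finset ι) (x : ι → E) :
    q (∑ i ∈ s, x i) ≤ ∑ i ∈ s, q (x i) :=
  Finset.le_sum_of_subadditive q (map_zero q).le (map_add_le_add q) s x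

variable {q : Seminorm ℝ E} {a : E}

/-- Disjointifying `e` removes from `e n` at most `2⁻ⁿ • a` plus its infimum with `4ⁿ` times the
earlier sum. The latter has seminorm at most `n * 4ⁿ * 16⁻ⁿ ≤ 2⁻ⁿ`. -/
theorem tendsto_of_inf_le_inv_pow (hq : IsLatticeSeminorm q) (hd : DisjointNullOn q a)
    {e : ℕ → E} (he : ∀ n, 0 ≤ e n) (hea : ∀ n, e n ≤ a)
    (hsmall : ∀ n, ∀ i < n, q (e n ⊓ e i) ≤ ((16 : ℝ) ^ n)⁻¹) :
    Tendsto (fun n => q (e n)) atTop (𝓝 0) := by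
  have ha : 0 ≤ a := (he 0).trans (hea 0)
  have hz : ∀ n, ((2 : ℝ) ^ n)⁻¹ • e n ≤ a := fun n =>
    calc ((2 : ℝ) ^ n)⁻¹ • e n ≤ (1 : ℝ) • e n :=
          smul_le_smul_of_nonneg_right
            (inv_le_one_of_one_le₀ (one_le_pow₀ (by norm_num))) (he n)
      _ ≤ a := by rw [one_smul]; exact hea n
  have hdis := disjointSeq_disjointify he hz
  set v : ℕ → E := fun n =>
    (e n - (4 : ℝ) ^ n • ∑ i ∈ Finset.range n, e i - ((2 : ℝ) ^ n)⁻¹ • a)⁺ with hv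
  have hsum : ∀ n, 0 ≤ (4 : ℝ) ^ n • ∑ i ∈ Finset.range n, e i := fun n =>
    smul_nonneg (by positivity) (Finset.sum_nonneg fun i _ => he i)
  have hpa : ∀ n, 0 ≤ ((2 : ℝ) ^ n)⁻¹ • a := fun n => smul_nonneg (by positivity) ha
  have hva : ∀ n, v n ≤ a := by
    intro n
    refine sup_le ?_ ha
    exact ((sub_le_self _ (hpa n)).trans (sub_le_self _ (hsum n))).trans (hea n)
  have hvlim := hd v (fun n => posPart_nonneg _) hva hdis
  have hbound : ∀ n, q (e n) ≤ q (v n) + ((1 / 2 : ℝ) ^ n + (1 / 2 : ℝ) ^ n * q a) := by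
    intro n
    set s := (4 : ℝ) ^ n • ∑ i ∈ Finset.range n, e i with hs
    have h1 : e n ≤ v n + ((2 : ℝ) ^ n)⁻¹ • a + e n ⊓ s := by
      conv_lhs => rw [eq_posPart_sub_add_inf (e n) s]
      gcongr
      exact sup_le (le_posPart_sub_add _ _) (add_nonneg (posPart_nonneg _) (hpa n))
    have h2 : q (e n ⊓ s) ≤ (1 / 2 : ℝ) ^ n := by
      have h3 : e n ⊓ s ≤ ∑ i ∈ Finset.range n, (4 : ℝ) ^ n • (e n ⊓ e i) := by
        rw [hs, Finset.smul_sum]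
        refine (inf_sum_le_sum_inf (he n) _ _ fun i _ => smul_nonneg (by positivity) (he i)).trans ?_
        exact Finset.sum_le_sum fun i _ => smul_inf_le (one_le_pow₀ (by norm_num)) (he n)
      refine (hq.mono (le_inf (he n) (hsum n)) h3).trans ((seminorm_sum_le _ _ _).trans ?_)
      calc ∑ i ∈ Finset.range n, q ((4 : ℝ) ^ n • (e n ⊓ e i))
          ≤ ∑ i ∈ Finset.range n, (4 : ℝ) ^ n * ((16 : ℝ) ^ n)⁻¹ := by
            refine Finset.sum_le_sum fun i hi => ?_
            rw [map_smul_eq_mul, Real.norm_of_nonneg (by positivity)]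
            gcongr
            exact hsmall n i (Finset.mem_range.1 hi)
        _ = n * (4 : ℝ)⁻¹ ^ n := by
            rw [Finset.sum_const, Finset.card_range, nsmul_eq_mul, ← inv_pow, ← mul_pow]
            norm_num
        _ ≤ 2 ^ n * (4 : ℝ)⁻¹ ^ n := by
            gcongr
            exact_mod_cast Nat.lt_two_pow_self.le
        _ = (1 / 2 : ℝ) ^ n := by rw [← mul_pow]; norm_num
    calc q (e n) ≤ q (v n + ((2 : ℝ) ^ n)⁻¹ • a + e n ⊓ s) := hq.mono (he n) h1
      _ ≤ q (v n) + q (((2 : ℝ) ^ n)⁻¹ • a) + q (e n ⊓ s) :=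
          (map_add_le_add q _ _).trans (by gcongr; exact map_add_le_add q _ _)
      _ ≤ q (v n) + (1 / 2 : ℝ) ^ n * q a + (1 / 2 : ℝ) ^ n := by
          gcongr
          rw [map_smul_eq_mul, Real.norm_of_nonneg (by positivity), one_div, inv_pow]
      _ = _ := by ring
  have hpow : Tendsto (fun n => (1 / 2 : ℝ) ^ n) atTop (𝓝 0) :=
    tendsto_pow_atTop_nhds_zero_of_lt_one (by norm_num) (by norm_num)
  refine squeeze_zero (fun n => apply_nonneg q _) hbound ?_
  simpa using hvlim.add (hpow.add (hpow.mul_const (q a)))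

/-- Induction on the number of terms with zero infimum. For fixed `i`, the sequence `e n ⊓ e i`
needs one term fewer, so it tends to zero, and a sparse subsequence meets the bound of
`tendsto_of_inf_le_inv_pow`. -/
theorem tendsto_of_finset_lowerBound_nonpos (hq : IsLatticeSeminorm q) (hd : DisjointNullOn q a)
    (k : ℕ) : ∀ {e : ℕ → E}, (∀ n, 0 ≤ e n) → (∀ n, e n ≤ a) →
      (∀ s : Finset ℕ, s.card = k + 1 → ∀ x, (∀ i ∈ s, x ≤ e i) → x ≤ 0) →
      Tendsto (fun n => q (e n)) atTop (𝓝 0) := by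
  induction k with
  | zero =>
    intro e he hea h
    have : ∀ n, e n = 0 := fun n => le_antisymm (h {n} (by simp) _ (by simp)) (he n)
    simp [this]
  | succ k ih =>
    intro e he hea h
    refine tendsto_of_subseq_tendsto fun ns hns => ?_
    obtain ⟨φ, hφ, hmono⟩ := strictMono_subseq_of_tendsto_atTop hns
    set e' : ℕ → E := e ∘ ns ∘ φ with he'
    have h' : ∀ s : Finset ℕ, s.card = k + 2 → ∀ x, (∀ i ∈ s, x ≤ e' i) → x ≤ 0 := by
      intro s hs x hx
      refine h (s.map ⟨ns ∘ φ, hmono.injective⟩) (by simpa) x ?_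
      intro i hi
      obtain ⟨j, hj, rfl⟩ := Finset.mem_map.1 hi
      exact hx j hj
    have hlim : ∀ i, Tendsto (fun n => q (e' n ⊓ e' i)) atTop (𝓝 0) := by
      intro i
      -- The shift keeps `i` out of the other indices, so adjoining it really adds a term.
      refine (tendsto_add_atTop_iff_nat (i + 1)).1 (ih (fun n => le_inf (he _) (he _))
        (fun n => inf_le_left.trans (hea _)) fun s hs x hx => ?_)
      refine h' (insert i (s.map (addRightEmbedding (i + 1)))) ?_ x ?_
      · rw [Finset.card_insert_of_notMem, Finset.card_map, hs]
        simp only [Finset.mem_map, addRightEmbedding_apply]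
        rintro ⟨j, -, hj⟩
        omega
      · intro j hj
        rcases Finset.mem_insert.1 hj with rfl | hj
        · obtain ⟨t, ht⟩ : s.Nonempty := Finset.card_pos.1 (by omega)
          exact (hx t ht).trans inf_le_right
        · obtain ⟨t, ht, rfl⟩ := Finset.mem_map.1 hj
          exact (hx t ht).trans inf_le_left
    have hex : ∀ N, ∃ M > N, ∀ i ≤ N, q (e' M ⊓ e' i) ≤ ((16 : ℝ) ^ (N + 1))⁻¹ := by
      intro N
      have h1 : ∀ᶠ n in atTop, ∀ i ∈ Finset.range (N + 1),
          q (e' n ⊓ e' i) ≤ ((16 : ℝ) ^ (N + 1))⁻¹ :=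
        (Finset.eventually_all _).2 fun i _ => (hlim i).eventually_le_const (by positivity)
      obtain ⟨M, hM1, hM2⟩ := (h1.and (eventually_gt_atTop N)).exists
      exact ⟨M, hM2, fun i hi => hM1 i (Finset.mem_range.2 (by omega))⟩
    choose g hg hg' using hex
    let ψ : ℕ → ℕ := fun n => g^[n] 0
    have hψs : ∀ n, ψ (n + 1) = g (ψ n) := fun n => Function.iterate_succ_apply' g n 0
    have hψ : StrictMono ψ := strictMono_nat_of_lt_succ fun n => by rw [hψs]; exact hg _
    refine ⟨fun n => φ (ψ n), ?_⟩
    refine tendsto_of_inf_le_inv_pow (e := fun n => e' (ψ n)) hq hd (fun n => he _)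
      (fun n => hea _) fun n i hi => ?_
    obtain ⟨m, rfl⟩ : ∃ m, n = m + 1 := ⟨n - 1, by omega⟩
    rw [hψs]
    refine (hg' (ψ m) (ψ i) (hψ.monotone (by omega))).trans ?_
    have := hψ.id_le m
    simp only [id] at this
    gcongr
    norm_num

/-- Any lower bound of `k + 1` of the `d n` is at most `a / (k + 1)`, as their sum is at most `a`.
Hence any `k + 1` of the elements `(d n - a / (k + 1))⁺` have zero infimum, and the truncation costs
only `q a / (k + 1)`. -/
theorem tendsto_of_sum_le (hq : IsLatticeSeminorm q) (hd : DisjointNullOn q a) {d : ℕ → E}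
    (hd0 : ∀ n, 0 ≤ d n) (hsum : ∀ N, ∑ n ∈ Finset.range N, d n ≤ a) :
    Tendsto (fun n => q (d n)) atTop (𝓝 0) := by
  have ha : 0 ≤ a := by simpa using hsum 0
  have hda : ∀ n, d n ≤ a := fun n =>
    (Finset.single_le_sum (f := d) (fun i _ => hd0 i) (Finset.self_mem_range_succ n)).trans
      (hsum (n + 1))
  refine Metric.tendsto_atTop.2 fun ε hε => ?_
  obtain ⟨k, hk⟩ := exists_nat_gt (q a / (ε / 2))
  have hk' : ((k : ℝ) + 1)⁻¹ * q a ≤ ε / 2 := by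
    rw [inv_mul_le_iff₀ (by positivity)]
    rw [div_lt_iff₀ (by positivity)] at hk
    nlinarith
  set δ : ℝ := ((k : ℝ) + 1)⁻¹ with hδ
  have hδa : 0 ≤ δ • a := smul_nonneg (by positivity) ha
  have hlim : Tendsto (fun n => q ((d n - δ • a)⁺)) atTop (𝓝 0) := by
    refine tendsto_of_finset_lowerBound_nonpos hq hd k (fun n => posPart_nonneg _)
      (fun n => sup_le ((sub_le_self _ hδa).trans (hda n)) ha) fun s hs x hx => ?_
    have hne : s.Nonempty := Finset.card_pos.1 (by omega)
    let _ : DistribLattice E := AddCommGroup.toDistribLattice E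
    set m := s.inf' hne fun i => d i - δ • a with hm
    have hm0 : m ≤ 0 := by
      have h1 : (k + 1 : ℝ) • (m + δ • a) ≤ (k + 1 : ℝ) • δ • a := by
        calc (k + 1 : ℝ) • (m + δ • a) = ∑ i ∈ s, (m + δ • a) := by
              rw [Finset.sum_const, hs, ← Nat.cast_smul_eq_nsmul ℝ]; simp
          _ ≤ ∑ i ∈ s, d i := Finset.sum_le_sum fun i hi => by
              rw [← le_sub_iff_add_le]
              exact Finset.inf'_le _ hi
          _ ≤ ∑ i ∈ Finset.range (s.sup id + 1), d i :=
              Finset.sum_le_sum_of_subset_of_nonneg (fun i hi => Finset.mem_range.2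
                (Nat.lt_succ_of_le (Finset.le_sup (f := id) hi))) fun i _ _ => hd0 i
          _ ≤ a := hsum _
          _ = _ := by rw [smul_smul, hδ, mul_inv_cancel₀ (by positivity), one_smul]
      have h2 := (smul_le_smul_iff_of_pos_left (by positivity : (0 : ℝ) < k + 1)).1 h1
      exact nonpos_of_add_le_left h2
    calc x ≤ s.inf' hne fun i => (d i - δ • a) ⊔ 0 := Finset.le_inf' _ _ hx
      _ = m ⊔ 0 := (Finset.inf'_sup_distrib_right hne _ _).symm
      _ = 0 := sup_eq_right.2 hm0
  obtain ⟨N, hN⟩ := eventually_atTop.1 (hlim.eventually_lt_const (half_pos hε))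
  refine ⟨N, fun n hn => ?_⟩
  rw [Real.dist_eq, sub_zero, abs_of_nonneg (apply_nonneg q _)]
  calc q (d n) ≤ q ((d n - δ • a)⁺ + δ • a) := hq.mono (hd0 n) (le_posPart_sub_add _ _)
    _ ≤ q ((d n - δ • a)⁺) + q (δ • a) := map_add_le_add q _ _
    _ = q ((d n - δ • a)⁺) + δ * q a := by
        rw [map_smul_eq_mul, Real.norm_of_nonneg (by positivity)]
    _ < ε := by linarith [hN n hn]

/-- Monotone sequences in `[0, a]` are Cauchy for `q`. -/
theorem exists_forall_sub_le_of_monotone (hq : IsLatticeSeminorm q) (hd : DisjointNullOn q a)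
    {y : ℕ → E} (hy : Monotone y) (hy0 : ∀ n, 0 ≤ y n) (hya : ∀ n, y n ≤ a) {ε : ℝ} (hε : 0 < ε) :
    ∃ N, ∀ n ≥ N, q (y n - y N) ≤ ε := by
  by_contra! H
  choose g hg hg' using H
  let φ : ℕ → ℕ := fun n => g^[n] 0
  have hφ : ∀ n, φ (n + 1) = g (φ n) := fun n => Function.iterate_succ_apply' g n 0
  have hlim := tendsto_of_sum_le hq hd (d := fun n => y (φ (n + 1)) - y (φ n))
    (fun n => sub_nonneg.2 (hy (by rw [hφ]; exact hg _))) (fun N => by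
      rw [Finset.sum_range_sub fun n => y (φ n)]
      exact (sub_le_self _ (hy0 _)).trans (hya _))
  obtain ⟨n, hn⟩ := (hlim.eventually_lt_const hε).exists
  rw [hφ] at hn
  exact (hg' (φ n)).not_gt hn

/-- Sequences in `[0, a]` tending rapidly to zero for each lattice seminorm of a family dominated
by `q` have terms which are uniformly small. -/
theorem exists_forall_le_of_le_inv_pow (hq : IsLatticeSeminorm q) (hd : DisjointNullOn q a)
    {ι : Type*} {p : ι → Seminorm ℝ E} (hp : ∀ j, IsLatticeSeminorm (p j))
    (hpq : ∀ j x, p j x ≤ q x) {w : ℕ → E} (hw0 : ∀ n, 0 ≤ w n) (hwa : ∀ n, w n ≤ a)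
    {C : ι → ℝ} (hpw : ∀ j n, p j (w n) ≤ C j * (1 / 2) ^ n) {ε : ℝ} (hε : 0 < ε) :
    ∃ n, ∀ j, p j (w n) ≤ ε := by
  have ha : 0 ≤ a := (hw0 0).trans (hwa 0)
  -- `y n N` is the supremum of the `w k` with `n ≤ k ≤ n + N`.
  let y : ℕ → ℕ → E := fun n => partialSups fun k => w (n + k)
  have hw_le : ∀ n k N, k ≤ N → w (n + k) ≤ y n N := fun n k N h =>
    le_partialSups_of_le (fun k => w (n + k)) h
  have hy0 : ∀ n N, 0 ≤ y n N := fun n N => (hw0 _).trans (hw_le n 0 N (Nat.zero_le _))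
  have hya : ∀ n N, y n N ≤ a := fun n N => partialSups_le _ _ _ fun k _ => hwa _
  have hymono : ∀ n, Monotone (y n) := fun n => (partialSups _).monotone
  choose N hN using fun n => exists_forall_sub_le_of_monotone hq hd (hymono n) (hy0 n) (hya n)
    (show 0 < ε / 4 * (1 / 2) ^ n by positivity)
  -- `b n` is the infimum of the `y i (N i)` with `i ≤ n`.
  let b : ℕ → E := fun n => (Finset.range (n + 1)).inf' Finset.nonempty_range_add_one fun i => y i (N i)
  have hb0 : ∀ n, 0 ≤ b n := fun n => Finset.le_inf' _ _ fun i _ => hy0 _ _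
  have hba : ∀ n, b n ≤ a := fun n =>
    (Finset.inf'_le _ (Finset.self_mem_range_succ n)).trans (hya _ _)
  have hbanti : Antitone b := fun m n hmn =>
    Finset.inf'_mono _ (Finset.range_subset_range.2 (by omega)) _
  obtain ⟨n, hn⟩ := exists_forall_sub_le_of_monotone hq hd (y := fun n => a - b n)
    (fun _ _ h => sub_le_sub_left (hbanti h) _) (fun n => sub_nonneg.2 (hba n))
    (fun n => sub_le_self _ (hb0 n)) (half_pos hε)
  refine ⟨n, fun j => ?_⟩
  have hbm : ∀ m, p j (b m) ≤ 2 * C j * (1 / 2) ^ m := by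
    intro m
    have h1 : b m ≤ ∑ k ∈ Finset.range (N m + 1), w (m + k) := by
      refine (Finset.inf'_le _ (Finset.self_mem_range_succ m)).trans ?_
      refine partialSups_le _ _ _ fun k hk => ?_
      exact Finset.single_le_sum (f := fun k => w (m + k)) (fun i _ => hw0 _)
        (Finset.mem_range.2 (by omega))
    have hC : 0 ≤ C j := by
      have := (apply_nonneg (p j) (w 0)).trans (hpw j 0)
      simpa using this
    calc p j (b m) ≤ ∑ k ∈ Finset.range (N m + 1), p j (w (m + k)) :=
          ((hp j).mono (hb0 m) h1).trans (seminorm_sum_le _ _ _)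
      _ ≤ ∑ k ∈ Finset.range (N m + 1), C j * (1 / 2) ^ m * (1 / 2) ^ k :=
          Finset.sum_le_sum fun k _ => (hpw j _).trans (by rw [pow_add, mul_assoc])
      _ = C j * (1 / 2) ^ m * ∑ k ∈ Finset.range (N m + 1), (1 / 2 : ℝ) ^ k := by
          rw [Finset.mul_sum]
      _ ≤ C j * (1 / 2) ^ m * 2 := by
          gcongr
          exact sum_geometric_two_le _
      _ = _ := by ring
  have hbn : p j (b n) ≤ ε / 2 := by
    have hpow : Tendsto (fun n => ε / 2 + 2 * C j * (1 / 2 : ℝ) ^ n) atTop (𝓝 (ε / 2 + 2 * C j * 0)) :=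
      ((tendsto_pow_atTop_nhds_zero_of_lt_one (by norm_num) (by norm_num)).const_mul _).const_add _
    rw [mul_zero, add_zero] at hpow
    -- `b n` is `q`-close to every later `b m`, and `p j (b m)` tends to zero. The rate depends on
    -- `j`, but `n` does not.
    refine ge_of_tendsto hpow ((eventually_ge_atTop n).mono fun m hm => ?_)
    calc p j (b n) = p j ((b n - b m) + b m) := by rw [sub_add_cancel]
      _ ≤ p j (b n - b m) + p j (b m) := map_add_le_add _ _ _
      _ ≤ _ := by
          refine add_le_add ((hpq j _).trans ?_) (hbm m)
          have := hn m hm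
          rwa [sub_sub_sub_cancel_left] at this
  let r : ℕ → E := fun i => y i (n + N n + N i) - y i (N i)
  have hr0 : ∀ i, 0 ≤ r i := fun i => sub_nonneg.2 (hymono i (by omega))
  -- For each `i ≤ n`, `w n` occurs in a longer partial supremum `y i`, which exceeds `y i (N i)` by
  -- only `r i`.
  have hwb : w n ≤ b n + ∑ i ∈ Finset.range (n + 1), r i := by
    rw [← sub_le_iff_le_add]
    refine Finset.le_inf' _ _ fun i hi => ?_
    rw [sub_le_iff_le_add]
    have hin : i ≤ n := by simpa [Nat.lt_succ_iff] using hi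
    calc w n = w (i + (n - i)) := by rw [Nat.add_sub_cancel' hin]
      _ ≤ y i (n + N n + N i) := hw_le _ _ _ (by omega)
      _ = y i (N i) + r i := by simp [r]
      _ ≤ _ := by
          gcongr
          exact Finset.single_le_sum (f := r) (fun i _ => hr0 i) hi
  calc p j (w n) ≤ p j (b n) + p j (∑ i ∈ Finset.range (n + 1), r i) :=
        ((hp j).mono (hw0 n) hwb).trans (map_add_le_add _ _ _)
    _ ≤ ε / 2 + ∑ i ∈ Finset.range (n + 1), ε / 4 * (1 / 2) ^ i := by
        refine add_le_add hbn ((seminorm_sum_le _ _ _).trans (Finset.sum_le_sum fun i _ => ?_))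
        exact (hpq j _).trans (hN i _ (by omega))
    _ ≤ ε / 2 + ε / 4 * 2 := by
        rw [← Finset.mul_sum]
        gcongr
        exact sum_geometric_two_le _
    _ = ε := by ring

end LatticeSeminorm

/-! ### Nearly constant convex combinations for a seminorm additive on the positive cone. -/

section ConvexCombinations

variable {E : Type*} [NormedAddCommGroup E] [NormedSpace ℝ E] [Lattice E] [IsOrderedAddMonoid E]
  [IsOrderedModule ℝ E]

/-- For real numbers, a point of `[0, a]` is within half a mesh of the grid. In the lattice, one
climbs the grid: consecutive differences `t` and `D` satisfy `t - D = 2 • B`, so `t ⊓ -D ≤ B`. -/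
theorem le_of_le_abs_sub_grid {m a x : E} (hm : 0 ≤ m) (hma : m ≤ a) {N : ℕ} (hN : 0 < N)
    (hx : ∀ j ≤ N, x ≤ |m - ((j : ℝ) / N) • a|) : x ≤ (1 / (2 * N) : ℝ) • a := by
  let _ : DistribLattice E := AddCommGroup.toDistribLattice E
  have ha : 0 ≤ a := hm.trans hma
  set B : E := (1 / (2 * N) : ℝ) • a with hB
  have key : ∀ k ≤ N, x ≤ B ⊔ (m - ((k : ℝ) / N) • a) := by
    intro k
    induction k with
    | zero =>
      intro _
      have := hx 0 (Nat.zero_le _)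
      simp only [Nat.cast_zero, zero_div, zero_smul, sub_zero, abs_of_nonneg hm] at this ⊢
      exact le_sup_of_le_right this
    | succ k ih =>
      intro hk
      have h1 := ih (by omega)
      have h2 := hx (k + 1) hk
      set t := m - ((k : ℝ) / N) • a with ht
      set D := m - (((k + 1 : ℕ) : ℝ) / N) • a with hD
      have hDt : t + -D = B + B := by
        rw [ht, hD, hB, ← add_smul]
        have : (1 / (2 * N) + 1 / (2 * N) : ℝ) = ((k + 1 : ℕ) : ℝ) / N - (k : ℝ) / N := by
          push_cast
          field_simp
          ring
        rw [this]
        module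
      have h3 : t ⊓ -D ≤ B := by
        have h4 : (2 : ℝ) • (t ⊓ -D) ≤ (2 : ℝ) • B := by
          rw [two_smul, two_smul, ← hDt]
          exact add_le_add inf_le_left inf_le_right
        exact (smul_le_smul_iff_of_pos_left (by norm_num : (0 : ℝ) < 2)).1 h4
      calc x ≤ (B ⊔ t) ⊓ (D ⊔ -D) := le_inf h1 h2
        _ = (B ⊔ t) ⊓ D ⊔ (B ⊓ -D ⊔ t ⊓ -D) := by rw [inf_sup_left, inf_sup_right B t (-D)]
        _ ≤ B ⊔ D := sup_le (inf_le_right.trans le_sup_right)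
            (sup_le (inf_le_left.trans le_sup_left) (h3.trans le_sup_left))
  refine (key N le_rfl).trans (sup_le le_rfl ?_)
  rw [div_self (by positivity), one_smul]
  exact (sub_nonpos.2 hma).trans (smul_nonneg (by positivity) ha)

/-- A uniform convexity estimate in the order interval `[0, a]`. -/
theorem seminorm_abs_sub_le_grid {μ : Seminorm ℝ E} (hμ : IsLatticeSeminorm μ)
    (hadd : ∀ x y : E, 0 ≤ x → 0 ≤ y → μ (x + y) = μ x + μ y) {a y z : E} (hy : 0 ≤ y)
    (hya : y ≤ a) (hz : 0 ≤ z) (hza : z ≤ a) {N : ℕ} (hN : 0 < N) :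
    μ |y - z| ≤ ∑ j ∈ Finset.range (N + 1), μ |y - ((j : ℝ) / N) • a| +
      ∑ j ∈ Finset.range (N + 1), μ |z - ((j : ℝ) / N) • a| -
      2 * ∑ j ∈ Finset.range (N + 1), μ |(1 / 2 : ℝ) • (y + z) - ((j : ℝ) / N) • a| +
      (1 / N : ℝ) * μ a := by
  -- `gap j` is the midpoint convexity defect of `|· - c j|`. It would equal `|y - z|` if `c j` were
  -- the midpoint, and some grid point is always near the midpoint.
  set c : ℕ → E := fun j => ((j : ℝ) / N) • a with hc
  set m := (1 / 2 : ℝ) • (y + z) with hm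
  set gap : ℕ → E := fun j => |y - c j| + |z - c j| - (2 : ℝ) • |m - c j| with hgap
  have hgap0 : ∀ j, 0 ≤ gap j := by
    intro j
    rw [hgap, sub_nonneg, ← abs_of_nonneg (zero_le_two : (0 : ℝ) ≤ 2), ← abs_smul']
    refine le_trans (le_of_eq ?_) (abs_add_le _ _)
    congr 1
    rw [hm]
    module
  have hle : |y - z| ≤ ∑ j ∈ Finset.range (N + 1), gap j + (1 / N : ℝ) • a := by
    have h1 : (1 / 2 : ℝ) • (|y - z| - ∑ j ∈ Finset.range (N + 1), gap j) ≤
        (1 / (2 * N) : ℝ) • a := by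
      refine le_of_le_abs_sub_grid (m := m) (smul_nonneg (by norm_num) (add_nonneg hy hz)) ?_ hN ?_
      · calc m ≤ (1 / 2 : ℝ) • (a + a) :=
              smul_le_smul_of_nonneg_left (add_le_add hya hza) (by norm_num)
          _ = a := by module
      · intro j hj
        have h2 : gap j ≤ ∑ j ∈ Finset.range (N + 1), gap j :=
          Finset.single_le_sum (f := gap) (fun i _ => hgap0 i) (Finset.mem_range.2 (by omega))
        have h3 : |y - z| ≤ |y - c j| + |z - c j| := by
          calc |y - z| = |(y - c j) + -(z - c j)| := by congr 1; abel
            _ ≤ |y - c j| + |-(z - c j)| := abs_add_le _ _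
            _ = _ := by rw [abs_neg]
        calc (1 / 2 : ℝ) • (|y - z| - ∑ j ∈ Finset.range (N + 1), gap j)
            ≤ (1 / 2 : ℝ) • (|y - c j| + |z - c j| - gap j) :=
              smul_le_smul_of_nonneg_left (sub_le_sub h3 h2) (by norm_num)
          _ = |m - c j| := by simp only [hgap]; module
    have h2 := smul_le_smul_of_nonneg_left h1 (zero_le_two : (0 : ℝ) ≤ 2)
    rw [smul_smul, smul_smul, show (2 : ℝ) * (1 / 2) = 1 by norm_num, one_smul,
      show (2 : ℝ) * (1 / (2 * N)) = 1 / N by field_simp] at h2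
    rwa [sub_le_iff_le_add'] at h2
  have hμgap : ∀ j, μ (gap j) = μ |y - c j| + μ |z - c j| - 2 * μ |m - c j| := by
    intro j
    have h1 : gap j + (2 : ℝ) • |m - c j| = |y - c j| + |z - c j| := sub_add_cancel _ _
    have h2 := hadd _ _ (hgap0 j) (smul_nonneg (zero_le_two : (0 : ℝ) ≤ 2) (abs_nonneg (m - c j)))
    rw [h1, hadd _ _ (abs_nonneg _) (abs_nonneg _), map_smul_eq_mul,
      Real.norm_of_nonneg zero_le_two] at h2
    linarith
  calc μ |y - z| ≤ μ (∑ j ∈ Finset.range (N + 1), gap j + (1 / N : ℝ) • a) :=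
        hμ.mono (abs_nonneg _) hle
    _ ≤ ∑ j ∈ Finset.range (N + 1), μ (gap j) + μ ((1 / N : ℝ) • a) :=
        (map_add_le_add _ _ _).trans (by gcongr; exact seminorm_sum_le _ _ _)
    _ = _ := by
        simp only [hμgap, Finset.sum_sub_distrib, Finset.sum_add_distrib, Finset.mul_sum]
        rw [map_smul_eq_mul, Real.norm_of_nonneg (by positivity)]

theorem convexHull_subset_Icc {x : ℕ → E} {a : E} (hx : ∀ n, x n ∈ Set.Icc 0 a) (s : Set ℕ) :
    convexHull ℝ (x '' s) ⊆ Set.Icc 0 a :=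
  convexHull_min (by rintro _ ⟨n, -, rfl⟩; exact hx n) (convex_Icc 0 a)

/-- Convex combinations of the tails of a sequence in `[0, a]` can be chosen close to each other
for a seminorm that is additive on the positive cone. -/
theorem exists_convexHull_seminorm_le {μ : Seminorm ℝ E} (hμ : IsLatticeSeminorm μ)
    (hadd : ∀ x y : E, 0 ≤ x → 0 ≤ y → μ (x + y) = μ x + μ y) {a : E} {x : ℕ → E}
    (hx : ∀ n, x n ∈ Set.Icc 0 a) {δ : ℝ} (hδ : 0 < δ) :
    ∃ n, ∃ y ∈ convexHull ℝ (x '' Set.Ici n), ∀ k ≥ n, ∃ z ∈ convexHull ℝ (x '' Set.Ici k),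
      μ |y - z| ≤ δ := by
  obtain ⟨N, hN⟩ := exists_nat_gt (μ a / (δ / 2))
  have hN0 : 0 < N := by
    have : (0 : ℝ) < N := lt_of_le_of_lt (div_nonneg (apply_nonneg μ a) (by positivity)) hN
    exact_mod_cast this
  have hNδ : (1 / N : ℝ) * μ a ≤ δ / 2 := by
    rw [div_lt_iff₀ (by positivity)] at hN
    rw [one_div, inv_mul_le_iff₀ (by positivity)]
    linarith
  let Φ : E → ℝ := fun y => ∑ j ∈ Finset.range (N + 1), μ |y - ((j : ℝ) / N) • a|
  let C : ℕ → Set E := fun n => convexHull ℝ (x '' Set.Ici n)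
  have hCx : ∀ n, x n ∈ C n := fun n => subset_convexHull ℝ _ ⟨n, Set.mem_Ici.2 le_rfl, rfl⟩
  have hCanti : Antitone C := fun m n h => convexHull_mono (Set.image_mono (Set.Ici_subset_Ici.2 h))
  have hbdd : ∀ n, BddBelow (Φ '' C n) := fun n => ⟨0, by
    rintro _ ⟨y, -, rfl⟩
    exact Finset.sum_nonneg fun j _ => apply_nonneg μ _⟩
  have hne : ∀ n, (Φ '' C n).Nonempty := fun n => ⟨_, x n, hCx n, rfl⟩
  let I : ℕ → ℝ := fun n => sInf (Φ '' C n)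
  have hI : BddAbove (Set.range I) := by
    refine ⟨∑ j ∈ Finset.range (N + 1), μ a, ?_⟩
    rintro _ ⟨n, rfl⟩
    refine (csInf_le (hbdd n) ⟨x n, hCx n, rfl⟩).trans (Finset.sum_le_sum fun j hj => ?_)
    have ha : 0 ≤ a := (hx n).1.trans (hx n).2
    have hj' : ((j : ℝ) / N) ≤ 1 := by
      rw [div_le_one (by positivity)]
      exact_mod_cast Nat.lt_succ_iff.1 (Finset.mem_range.1 hj)
    refine hμ.mono (abs_nonneg _) (abs_le'.2 ⟨?_, ?_⟩)
    · exact (sub_le_self _ (smul_nonneg (by positivity) ha)).trans (hx n).2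
    · rw [neg_sub]
      refine (sub_le_self _ (hx n).1).trans ?_
      exact (smul_le_smul_of_nonneg_right hj' ha).trans (one_smul ℝ a).le
  -- The infima of the convex function `Φ` over the tail hulls increase to a finite limit.
  -- Near-minimisers `y`, `z` and their midpoint have nearly equal values, so the convexity defect
  -- is at most `4 * (δ / 8)`.
  obtain ⟨n, hn⟩ := exists_lt_of_lt_ciSup
    (sub_lt_self (⨆ n, I n) (show 0 < δ / 8 by positivity))
  have hclose : ∀ k, ∃ z ∈ C k, Φ z < (⨆ n, I n) + δ / 8 := by
    intro k
    obtain ⟨_, ⟨z, hz, rfl⟩, hlt⟩ := exists_lt_of_csInf_lt (hne k)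
      (lt_add_of_pos_right (I k) (show 0 < δ / 8 by positivity))
    exact ⟨z, hz, hlt.trans_le (by gcongr; exact le_ciSup hI k)⟩
  obtain ⟨y, hy, hyΦ⟩ := hclose n
  refine ⟨n, y, hy, fun k hk => ?_⟩
  obtain ⟨z, hz, hzΦ⟩ := hclose k
  refine ⟨z, hz, ?_⟩
  have hyI := convexHull_subset_Icc hx _ hy
  have hzI := convexHull_subset_Icc hx _ hz
  have hmid : (1 / 2 : ℝ) • (y + z) ∈ C n := by
    rw [smul_add]
    exact convex_convexHull ℝ _ hy (hCanti hk hz) (by norm_num) (by norm_num) (by norm_num)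
  have hmidΦ : I n ≤ Φ ((1 / 2 : ℝ) • (y + z)) := csInf_le (hbdd n) ⟨_, hmid, rfl⟩
  have := seminorm_abs_sub_le_grid hμ hadd hyI.1 hyI.2 hzI.1 hzI.2 hN0
  change _ ≤ Φ y + Φ z - 2 * Φ _ + _ at this
  linarith

end ConvexCombinations

/-! ### Almost Dunford–Pettis operators on disjointly weakly compact sets. -/

section AlmostDunfordPettis

variable {E : Type*} [NormedAddCommGroup E] [NormedSpace ℝ E] [Lattice E] [IsOrderedAddMonoid E]
  [IsOrderedModule ℝ E] [HasSolidNorm E] {X : Type*} [NormedAddCommGroup X] [NormedSpace ℝ X]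

theorem isLatticeSeminorm_latticeSeminorm (T : E →L[ℝ] X) :
    IsLatticeSeminorm (latticeSeminorm T) := fun _ _ h => solidSeminorm_mono h

/-- Near-maximisers below the `z n` are again disjoint and order bounded, hence weakly null. -/
theorem IsAlmostDunfordPettis.disjointNullOn {T : E →L[ℝ] X} (hT : IsAlmostDunfordPettis T)
    (a : E) : DisjointNullOn (latticeSeminorm T) a := by
  intro z hz0 hza hz
  have := fun n : ℕ => exists_lt_of_lt_solidSeminorm (sub_lt_self
    (latticeSeminorm T (z n)) (show (0 : ℝ) < 1 / ((n : ℝ) + 1) by positivity))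
  choose y _ hyz hy using this
  have hydis : DisjointSeq y := hz.mono hyz
  have hya : ∀ n, |y n| ≤ |a| := fun n => (hyz n).trans (by
    rw [abs_of_nonneg (hz0 n), abs_of_nonneg ((hz0 n).trans (hza n))]
    exact hza n)
  have hlim := (hT y hydis (hydis.weaklyNull_of_abs_le hya)).add
    (tendsto_one_div_add_atTop_nhds_zero_nat (𝕜 := ℝ))
  rw [add_zero] at hlim
  exact squeeze_zero (fun n => apply_nonneg _ _) (fun n => by linarith [hy n]) hlim

theorem norm_le_of_mem_solidClosure {K : Set E} {R : ℝ} (hR : ∀ x ∈ K, ‖x‖ ≤ R) {x : E}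
    (hx : x ∈ LatticeOrderedAddCommGroup.solidClosure K) : ‖x‖ ≤ R := by
  obtain ⟨y, hy, hxy⟩ := hx
  exact (HasSolidNorm.solid hxy).trans (hR y hy)

/-- An operator sending the disjoint sequences of a bounded solid set to null sequences is small
on the part of the set lying outside of some order interval. -/
theorem exists_forall_norm_posPart_sub_le [CompleteSpace E] {K : Set E}
    (hK : IsDisjointlyWeaklyCompact K) {T : E →L[ℝ] X} (hT : IsAlmostDunfordPettis T) {ε : ℝ}
    (hε : 0 < ε) : ∃ a : E, 0 ≤ a ∧ ∀ x ∈ LatticeOrderedAddCommGroup.solidClosure K,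
      ‖T ((|x| - a)⁺)‖ ≤ ε := by
  by_contra! H
  choose! g hgK hgT using H
  -- Each counterexample is taken against `4 ^ n` times the sum of the earlier ones, as
  -- disjointification requires. The disjoint `v n` then stay in the solid hull and differ from the
  -- counterexamples by at most `2⁻ⁿ • z`.
  let s : ℕ → E := fun n => Nat.rec 0 (fun n s => s + |g ((4 : ℝ) ^ n • s)|) n
  let x : ℕ → E := fun n => |g ((4 : ℝ) ^ n • s n)|
  have hs : ∀ n, s n = ∑ i ∈ Finset.range n, x i := by
    intro n
    induction n with
    | zero => rfl
    | succ n ih => rw [Finset.sum_range_succ, ← ih]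
  have hx0 : ∀ n, 0 ≤ x n := fun n => abs_nonneg _
  have hs0 : ∀ n, 0 ≤ (4 : ℝ) ^ n • s n := fun n => smul_nonneg (by positivity) (by
    rw [hs]; exact Finset.sum_nonneg fun i _ => hx0 i)
  obtain ⟨R, hR⟩ := hK.1.exists_norm_le
  have hxR : ∀ n, ‖x n‖ ≤ R := fun n => by
    rw [norm_abs_eq_norm]
    exact norm_le_of_mem_solidClosure hR (hgK _ (hs0 n))
  have hsummable : Summable fun n => ((2 : ℝ) ^ n)⁻¹ • x n := by
    refine Summable.of_norm_bounded (g := fun n => (1 / 2 : ℝ) ^ n * R)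
      (summable_geometric_two.mul_right R) fun n => ?_
    rw [norm_smul, norm_inv, norm_pow, Real.norm_two, one_div, inv_pow]
    gcongr
    exact hxR n
  have hterm : ∀ n, 0 ≤ ((2 : ℝ) ^ n)⁻¹ • x n := fun n => smul_nonneg (by positivity) (hx0 n)
  set z := ∑' n, ((2 : ℝ) ^ n)⁻¹ • x n with hz
  have hxz : ∀ n, ((2 : ℝ) ^ n)⁻¹ • x n ≤ z := fun n => hsummable.le_tsum n fun i _ => hterm i
  have hz0 : 0 ≤ z := (hterm 0).trans (hxz 0)
  have hdis := disjointSeq_disjointify hx0 hxz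
  simp only [← hs] at hdis
  set v : ℕ → E := fun n => (x n - (4 : ℝ) ^ n • s n - ((2 : ℝ) ^ n)⁻¹ • z)⁺ with hv
  have hpz : ∀ n, 0 ≤ ((2 : ℝ) ^ n)⁻¹ • z := fun n => smul_nonneg (by positivity) hz0
  have hvK : ∀ n, v n ∈ LatticeOrderedAddCommGroup.solidClosure K := by
    intro n
    obtain ⟨y, hyK, hy⟩ := hgK _ (hs0 n)
    refine ⟨y, hyK, le_trans ?_ hy⟩
    rw [abs_of_nonneg (posPart_nonneg _)]
    exact sup_le ((sub_le_self _ (hpz n)).trans (sub_le_self _ (hs0 n))) (hx0 n)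
  have hTv := hT v hdis (hK.2 v hvK hdis)
  have hbound : ∀ n, ε ≤ ‖T (v n)‖ + ‖T‖ * ((1 / 2 : ℝ) ^ n * ‖z‖) := by
    intro n
    set w := (x n - (4 : ℝ) ^ n • s n)⁺ with hw
    have h1 : ‖w - v n‖ ≤ (1 / 2 : ℝ) ^ n * ‖z‖ := by
      have h2 : |w - v n| ≤ |((2 : ℝ) ^ n)⁻¹ • z| := by
        rw [abs_of_nonneg (hpz n), abs_of_nonneg (sub_nonneg.2 (posPart_mono (sub_le_self _ (hpz n)))),
          sub_le_iff_le_add']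
        exact sup_le (le_posPart_sub_add _ _) (add_nonneg (posPart_nonneg _) (hpz n))
      refine (HasSolidNorm.solid h2).trans (le_of_eq ?_)
      rw [norm_smul, norm_inv, norm_pow, Real.norm_two, one_div, inv_pow]
    calc ε ≤ ‖T w‖ := (hgT _ (hs0 n)).le
      _ = ‖T (v n) + T (w - v n)‖ := by rw [← map_add, add_sub_cancel]
      _ ≤ ‖T (v n)‖ + ‖T (w - v n)‖ := norm_add_le _ _
      _ ≤ _ := by
          gcongr
          exact (T.le_opNorm _).trans (by gcongr)
  have hpow : Tendsto (fun n => (1 / 2 : ℝ) ^ n) atTop (𝓝 0) :=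
    tendsto_pow_atTop_nhds_zero_of_lt_one (by norm_num) (by norm_num)
  have hlim := hTv.add ((hpow.mul_const ‖z‖).const_mul ‖T‖)
  simp only [zero_mul, mul_zero, add_zero] at hlim
  exact hε.not_ge (ge_of_tendsto' hlim hbound)

/-- The sum of a pointwise summable sequence of seminorms. -/
noncomputable def tsumSeminorm {F : Type*} [AddCommGroup F] [Module ℝ F] (p : ℕ → Seminorm ℝ F)
    (hp : ∀ x, Summable fun j => p j x) : Seminorm ℝ F :=
  Seminorm.of (fun x => ∑' j, p j x)
    (fun x y => by
      rw [← (hp x).tsum_add (hp y)]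
      exact (hp _).tsum_le_tsum (fun j => map_add_le_add _ _ _) ((hp x).add (hp y)))
    (fun c x => by simp only [map_smul_eq_mul, tsum_mul_left])

/-- Operators sending disjoint weakly null sequences to null sequences map disjointly weakly
compact sets to relatively weakly compact sets. -/
theorem IsDisjointlyWeaklyCompact.relativelyWeaklyCompact_image [CompleteSpace E]
    [CompleteSpace X] {K : Set E} (hK : IsDisjointlyWeaklyCompact K) {T : E →L[ℝ] X}
    (hT : IsAlmostDunfordPettis T) : RelativelyWeaklyCompact (T '' K) := by
  by_contra hnot
  obtain ⟨θ, hθ, f, s, hf, hs, hfs, hfs0⟩ :=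
    exists_seq_of_not_relativelyWeaklyCompact (T.lipschitz.isBounded_image hK.1) hnot
  choose x hxK hxs using hs
  obtain ⟨a, ha, haK⟩ := exists_forall_norm_posPart_sub_le hK hT (show 0 < θ / 8 by positivity)
  -- `x n` truncated to `[-a, a]`, then shifted by `a` into the positive cone. Each of the two
  -- truncated tails costs `θ / 8`.
  let t : ℕ → E := fun n => (x n)⁺ ⊓ a - (x n)⁻ ⊓ a + a
  have htI : ∀ n, t n ∈ Set.Icc 0 (a + a) := by
    intro n
    refine ⟨?_, ?_⟩
    · have h1 : (x n)⁻ ⊓ a ≤ a := inf_le_right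
      have h2 : 0 ≤ (x n)⁺ ⊓ a := le_inf (posPart_nonneg _) ha
      linear_combination (norm := exact le_of_eq (by module)) h1 + h2
    · have h1 : (x n)⁺ ⊓ a ≤ a := inf_le_right
      have h2 : 0 ≤ (x n)⁻ ⊓ a := le_inf (negPart_nonneg _) ha
      linear_combination (norm := exact le_of_eq (by module)) h1 + h2
  let G : ℕ → StrongDual ℝ E := fun m => (f m).comp T
  have hft : ∀ m n, |G m (t n) - G m a - f m (s n)| ≤ θ / 4 := by
    intro m n
    have h1 : t n - a - x n = ((x n)⁻ - a)⁺ - ((x n)⁺ - a)⁺ := by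
      have h2 := eq_posPart_sub_add_inf (x n)⁺ a
      have h3 := eq_posPart_sub_add_inf (x n)⁻ a
      have h4 := posPart_sub_negPart (x n)
      calc t n - a - x n = (x n)⁺ ⊓ a - (x n)⁻ ⊓ a - ((x n)⁺ - (x n)⁻) := by
            rw [h4]; simp only [t]; abel
        _ = ((x n)⁺ ⊓ a - (x n)⁺) + ((x n)⁻ - (x n)⁻ ⊓ a) := by abel
        _ = _ := by
            nth_rewrite 2 [h2]
            nth_rewrite 1 [h3]
            abel
    have h5 : G m (t n) - G m a - f m (s n) = f m (T (t n - a - x n)) := by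
      simp only [G, map_sub, hxs, ContinuousLinearMap.comp_apply]
    have h6 : ∀ y : E, |y| ≤ |x n| → 0 ≤ y → ‖T ((y - a)⁺)‖ ≤ θ / 8 := by
      intro y hy hy0
      have := haK y ⟨x n, hxK n, hy⟩
      rwa [abs_of_nonneg hy0] at this
    rw [h5, h1, ← Real.norm_eq_abs]
    refine ((f m).le_of_opNorm_le (hf m) _).trans ?_
    rw [one_mul, map_sub]
    refine (norm_sub_le _ _).trans ?_
    have h7 := h6 (x n)⁺ (by
      rw [abs_of_nonneg (posPart_nonneg _), ← posPart_add_negPart]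
      exact le_add_of_nonneg_right (negPart_nonneg _)) (posPart_nonneg _)
    have h8 := h6 (x n)⁻ (by
      rw [abs_of_nonneg (negPart_nonneg _), ← posPart_add_negPart]
      exact le_add_of_nonneg_left (posPart_nonneg _)) (negPart_nonneg _)
    linarith
  let q := latticeSeminorm T
  let p : ℕ → Seminorm ℝ E := fun j => latticeSeminorm (G j)
  have hpq : ∀ j y, p j y ≤ q y := fun j y => solidSeminorm_le fun z _ hz =>
    (((f j).le_of_opNorm_le (hf j) _).trans (one_mul _).le).trans (norm_le_latticeSeminorm hz)
  let p' : ℕ → Seminorm ℝ E := fun j => ((1 / 2 : NNReal) ^ j) • p j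
  have hp' : ∀ j y, p' j y = (1 / 2 : ℝ) ^ j * p j y := fun j y => by
    simp [p', NNReal.smul_def]
  have hsum : ∀ y, Summable fun j => p' j y := fun y =>
    Summable.of_nonneg_of_le (fun j => apply_nonneg _ _)
      (fun j => (hp' j y).le.trans (mul_le_mul_of_nonneg_left (hpq j y) (by positivity)))
      (summable_geometric_two.mul_right (q y))
  let μ := tsumSeminorm p' hsum
  have hμ : ∀ y, μ y = ∑' j, p' j y := fun _ => rfl
  have hμlat : IsLatticeSeminorm μ := fun y z h => by
    rw [hμ, hμ]
    refine (hsum y).tsum_le_tsum (fun j => ?_) (hsum z)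
    rw [hp', hp']
    gcongr
    exact isLatticeSeminorm_latticeSeminorm _ h
  have hμadd : ∀ y z : E, 0 ≤ y → 0 ≤ z → μ (y + z) = μ y + μ z := fun y z hy hz => by
    rw [hμ, hμ, hμ, ← (hsum y).tsum_add (hsum z)]
    refine tsum_congr fun j => ?_
    rw [hp', hp', hp', ← mul_add]
    congr 1
    exact latticeSeminorm_add_of_nonneg _ hy hz
  have hpμ : ∀ j y, p j y ≤ 2 ^ j * μ y := fun j y => by
    have h1 : p' j y ≤ μ y := (hsum y).le_tsum j fun i _ => apply_nonneg _ _
    rw [hp', one_div, inv_pow, inv_mul_le_iff₀ (by positivity)] at h1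
    exact h1
  have hw : ∀ n : ℕ, ∃ w : E, 0 ≤ w ∧ w ≤ a + a ∧ μ w ≤ (1 / 2) ^ n ∧ ∃ k, θ / 2 ≤ p k w := by
    intro n
    obtain ⟨n₀, y, hy, hyz⟩ := exists_convexHull_seminorm_le hμlat hμadd htI
      (show (0 : ℝ) < (1 / 2) ^ n by positivity)
    -- `y` involves finitely many `t i`, and late functionals vanish on the corresponding `s i`. A
    -- tail hull from `k` on has `G k` at least `G k a + 3 * θ / 4`, leaving a separation of `θ /
    -- 2`.
    have hyk : ∃ k₀, ∀ m ≥ k₀, G m y ≤ G m a + θ / 4 := by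
      have hconv : Convex ℝ {y : E | ∃ k₀, ∀ m ≥ k₀, G m y ≤ G m a + θ / 4} := by
        rintro y₁ ⟨k₁, h₁⟩ y₂ ⟨k₂, h₂⟩ b c hb hc hbc
        refine ⟨max k₁ k₂, fun m hm => ?_⟩
        rw [map_add, map_smul, map_smul, smul_eq_mul, smul_eq_mul]
        calc _ ≤ b * (G m a + θ / 4) + c * (G m a + θ / 4) := by
              gcongr
              · exact h₁ m (le_of_max_le_left hm)
              · exact h₂ m (le_of_max_le_right hm)
          _ = _ := by rw [← add_mul, hbc, one_mul]
      refine convexHull_min ?_ hconv hy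
      rintro _ ⟨i, -, rfl⟩
      refine ⟨i + 1, fun m hm => ?_⟩
      have h1 := (abs_le.1 (hft m i)).2
      rw [hfs0 i m hm] at h1
      linarith
    obtain ⟨k₀, hk₀⟩ := hyk
    set k := max k₀ n₀
    obtain ⟨z, hz, hyzμ⟩ := hyz k (le_max_right _ _)
    have hzk : G k a + 3 * θ / 4 ≤ G k z := by
      refine convexHull_min ?_ (convex_halfSpace_ge (f := G k) (G k).toLinearMap.isLinear _) hz
      rintro _ ⟨i, hi, rfl⟩
      have h1 := (abs_le.1 (hft k i)).1
      have h2 := hfs k i hi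
      change _ ≤ G k (t i)
      linarith
    have hyI := convexHull_subset_Icc htI _ hy
    have hzI := convexHull_subset_Icc htI _ hz
    refine ⟨|y - z|, abs_nonneg _, abs_le'.2 ⟨?_, ?_⟩, hyzμ, k, ?_⟩
    · exact (sub_le_self _ hzI.1).trans hyI.2
    · rw [neg_sub]
      exact (sub_le_self _ hyI.1).trans hzI.2
    · have h1 : ‖G k (z - y)‖ ≤ p k |y - z| :=
        norm_le_latticeSeminorm (by rw [abs_abs, abs_sub_comm])
      have h2 : G k z - G k y ≤ ‖G k (z - y)‖ := by
        rw [← map_sub]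
        exact Real.le_norm_self _
      have h3 := hk₀ k (le_max_left _ _)
      linarith
  choose w hw0 hwa hwμ hwk using hw
  obtain ⟨n, hn⟩ := exists_forall_le_of_le_inv_pow (isLatticeSeminorm_latticeSeminorm T)
    (hT.disjointNullOn (a + a)) (fun j => isLatticeSeminorm_latticeSeminorm (G j)) hpq hw0 hwa
    (C := fun j => 2 ^ j) (fun j n => (hpμ j _).trans (by gcongr; exact hwμ n))
    (show 0 < θ / 4 by positivity)
  obtain ⟨k, hk⟩ := hwk n
  linarith [hn k]

end AlmostDunfordPettis

/-! ### The Schur property of `ℓ¹` and norm compactness of weakly compact sets. -/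

section SummableSequences

variable {ι : Type*}

theorem summable_norm_of_lp_one (x : lp (fun _ : ι => ℝ) 1) : Summable fun i => ‖x i‖ := by
  simpa using (lp.memℓp x).summable (by simp)

theorem lp_one_norm_eq_tsum (x : lp (fun _ : ι => ℝ) 1) : ‖x‖ = ∑' i, ‖x i‖ := by
  simpa using lp.norm_eq_tsum_rpow (by simp) x

theorem summable_mul_of_lp_one {s : ι → ℝ} (hs : ∀ i, |s i| ≤ 1) (x : lp (fun _ : ι => ℝ) 1) :
    Summable fun i => x i * s i :=
  Summable.of_norm_bounded (summable_norm_of_lp_one x) fun i => by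
    rw [norm_mul]
    exact mul_le_of_le_one_right (norm_nonneg _) (hs i)

/-- The functional on `ℓ¹` induced by a sequence bounded by one. -/
noncomputable def lpOnePairing (s : ι → ℝ) (hs : ∀ i, |s i| ≤ 1) :
    StrongDual ℝ (lp (fun _ : ι => ℝ) 1) :=
  LinearMap.mkContinuous
    { toFun := fun x => ∑' i, x i * s i
      map_add' := fun x y => by
        rw [← (summable_mul_of_lp_one hs x).tsum_add (summable_mul_of_lp_one hs y)]
        exact tsum_congr fun i => add_mul _ _ _
      map_smul' := fun c x => by
        rw [RingHom.id_apply, smul_eq_mul, ← tsum_mul_left]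
        exact tsum_congr fun i => mul_assoc _ _ _ } 1
    (fun x => by
      rw [one_mul, lp_one_norm_eq_tsum]
      refine tsum_of_norm_bounded (summable_norm_of_lp_one x).hasSum fun i => ?_
      rw [norm_mul]
      exact mul_le_of_le_one_right (norm_nonneg _) (hs i))

theorem lpOnePairing_apply (s : ι → ℝ) (hs : ∀ i, |s i| ≤ 1) (x : lp (fun _ : ι => ℝ) 1) :
    lpOnePairing s hs x = ∑' i, x i * s i := rfl

theorem exists_dual_eq_coord (i : ι) :
    ∃ f : StrongDual ℝ (lp (fun _ : ι => ℝ) 1), ∀ x, f x = x i := by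
  classical
  refine ⟨lpOnePairing (fun j => if j = i then 1 else 0) fun j => ?_, fun x => ?_⟩
  · split_ifs <;> simp
  · rw [lpOnePairing_apply, tsum_eq_single i fun j hj => by simp [hj]]
    simp

/-- The Schur property of `ℓ¹`. -/
theorem WeaklyNull.tendsto_norm_of_lp_one {x : ℕ → lp (fun _ : ι => ℝ) 1} (hx : WeaklyNull x) :
    Tendsto (fun n => ‖x n‖) atTop (𝓝 0) := by
  classical
  rw [weaklyNull_iff_forall_dual] at hx
  have hcoord : ∀ i, Tendsto (fun n => |x n i|) atTop (𝓝 0) := fun i => by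
    obtain ⟨f, hf⟩ := exists_dual_eq_coord i
    have := (hx f).abs
    simpa only [hf, abs_zero] using this
  have hB : ∀ (s : ι → Set.Icc (-1 : ℝ) 1) i, |(s i : ℝ)| ≤ 1 := fun s i => abs_le.2 (s i).2
  refine Metric.tendsto_atTop.2 fun ε hε => ?_
  -- Baire category on the compact cube `[-1, 1]^ι`: some `F N` contains a basic open set, which
  -- restricts only finitely many coordinates `I`. Off `I`, the signs of `x n` may be used and
  -- recover the norm.
  let F : ℕ → Set (ι → Set.Icc (-1 : ℝ) 1) := fun N =>
    ⋂ n ≥ N, {s | |∑' i, x n i * (s i : ℝ)| ≤ ε / 2}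
  have hcont : ∀ n, Continuous fun s : ι → Set.Icc (-1 : ℝ) 1 => ∑' i, x n i * (s i : ℝ) := by
    intro n
    refine continuous_tsum (fun i => by fun_prop) (summable_norm_of_lp_one (x n)) fun i s => ?_
    rw [norm_mul]
    exact mul_le_of_le_one_right (norm_nonneg _) (hB s i)
  have hF : ∀ N, IsClosed (F N) := fun N =>
    isClosed_biInter fun n _ => isClosed_le (hcont n).abs continuous_const
  have hU : ⋃ N, F N = Set.univ := by
    refine Set.eq_univ_of_forall fun s => Set.mem_iUnion.2 ?_
    have h1 := (hx (lpOnePairing (fun i => (s i : ℝ)) (hB s))).abs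
    rw [abs_zero] at h1
    obtain ⟨N, hN⟩ := eventually_atTop.1 (h1.eventually_le_const (half_pos hε))
    exact ⟨N, Set.mem_iInter₂.2 fun n hn => hN n hn⟩
  have : Nonempty (ι → Set.Icc (-1 : ℝ) 1) := ⟨fun _ => ⟨0, by norm_num⟩⟩
  obtain ⟨N, s₀, hs₀⟩ := nonempty_interior_of_iUnion_of_closed hF hU
  obtain ⟨I, U, hIU, hsub⟩ := isOpen_pi_iff.1 isOpen_interior s₀ hs₀
  have hI : Tendsto (fun n => ∑ i ∈ I, 2 * |x n i|) atTop (𝓝 0) := by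
    have := tendsto_finsetSum I fun i _ => (hcoord i).const_mul 2
    simpa using this
  obtain ⟨N', hN'⟩ := eventually_atTop.1 (hI.eventually_lt_const (half_pos hε))
  refine ⟨max N N', fun n hn => ?_⟩
  rw [Real.dist_eq, sub_zero, abs_of_nonneg (norm_nonneg _)]
  have hsign : ∀ t : ℝ, (SignType.sign t : ℝ) ∈ Set.Icc (-1 : ℝ) 1 := fun t => by
    rcases lt_trichotomy t 0 with h | h | h <;> simp [h]
  let s : ι → Set.Icc (-1 : ℝ) 1 := fun i =>
    if i ∈ I then s₀ i else ⟨SignType.sign (x n i), hsign _⟩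
  have hsF : s ∈ F N := interior_subset (hsub fun i hi => by
    have hi' : i ∈ I := hi
    simp only [s, if_pos hi']
    exact (hIU i hi').2)
  have h1 : |∑' i, x n i * (s i : ℝ)| ≤ ε / 2 :=
    Set.mem_iInter₂.1 hsF n (le_of_max_le_left hn)
  have h2 : ‖x n‖ - ∑' i, x n i * (s i : ℝ) = ∑ i ∈ I, (‖x n i‖ - x n i * (s i : ℝ)) := by
    rw [lp_one_norm_eq_tsum, ← (summable_norm_of_lp_one (x n)).tsum_sub
      (summable_mul_of_lp_one (hB s) (x n))]
    refine tsum_eq_sum fun i hi => ?_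
    simp only [s, if_neg hi, self_mul_sign, Real.norm_eq_abs, sub_self]
  have h3 : ∑ i ∈ I, (‖x n i‖ - x n i * (s i : ℝ)) ≤ ∑ i ∈ I, 2 * |x n i| := by
    refine Finset.sum_le_sum fun i _ => ?_
    have h4 : |x n i * (s i : ℝ)| ≤ |x n i| := by
      rw [abs_mul]
      exact mul_le_of_le_one_right (abs_nonneg _) (hB s i)
    rw [Real.norm_eq_abs]
    linarith [neg_le_of_abs_le h4]
  have h5 := hN' n (le_of_max_le_right hn)
  linarith [le_of_abs_le h1]

/-- Relatively weakly compact subsets of `ℓ¹` are relatively norm sequentially compact. -/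
theorem RelativelyWeaklyCompact.exists_subseq_of_lp_one [Countable ι]
    {A : Set (lp (fun _ : ι => ℝ) 1)} (hA : RelativelyWeaklyCompact A)
    {x : ℕ → lp (fun _ : ι => ℝ) 1} (hx : ∀ n, x n ∈ A) :
    ∃ (y : lp (fun _ : ι => ℝ) 1) (φ : ℕ → ℕ), StrictMono φ ∧
      Tendsto (fun n => ‖x (φ n) - y‖) atTop (𝓝 0) := by
  set C := closure (toWeakSpace ℝ (lp (fun _ : ι => ℝ) 1) '' A) with hC
  have : CompactSpace C := isCompact_iff_compactSpace.1 hA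
  have hdual : ∀ f : StrongDual ℝ (lp (fun _ : ι => ℝ) 1),
      Continuous fun z : WeakSpace ℝ (lp (fun _ : ι => ℝ) 1) =>
        f ((toWeakSpace ℝ (lp (fun _ : ι => ℝ) 1)).symm z) :=
    fun f => WeakBilin.eval_continuous (topDualPairing ℝ (lp (fun _ : ι => ℝ) 1)).flip f
  let Ψ : C → ι → ℝ := fun z i => (toWeakSpace ℝ (lp (fun _ : ι => ℝ) 1)).symm z i
  have hΨ : Continuous Ψ := continuous_pi fun i => by
    obtain ⟨f, hf⟩ := exists_dual_eq_coord i
    have := (hdual f).comp (continuous_subtype_val (p := (· ∈ C)))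
    simpa only [Function.comp_def, hf] using this
  have hinj : Function.Injective Ψ := fun z z' h =>
    Subtype.ext ((toWeakSpace ℝ (lp (fun _ : ι => ℝ) 1)).symm.injective
      (lp.ext h))
  -- Countably many coordinates embed the weakly compact set `C` in `ℝ^ι`, so it is sequentially
  -- compact.
  have : FirstCountableTopology C :=
    (hΨ.isClosedEmbedding hinj).isInducing.firstCountableTopology
  obtain ⟨y, φ, hφ, hlim⟩ := CompactSpace.tendsto_subseq
    (fun n => (⟨toWeakSpace ℝ _ (x n), subset_closure ⟨_, hx n, rfl⟩⟩ : C))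
  refine ⟨(toWeakSpace ℝ _).symm y, φ, hφ, WeaklyNull.tendsto_norm_of_lp_one ?_⟩
  refine weaklyNull_iff_forall_dual.2 fun f => ?_
  have h1 := ((hdual f).tendsto (y : WeakSpace ℝ (lp (fun _ : ι => ℝ) 1))).comp
    ((continuous_subtype_val.tendsto y).comp hlim)
  have h2 := h1.sub_const (f ((toWeakSpace ℝ (lp (fun _ : ι => ℝ) 1)).symm y))
  rw [sub_self] at h2
  simpa only [Function.comp_def, LinearEquiv.symm_apply_apply, map_sub] using h2

end SummableSequences

/-! ### V*-sets through operators into `ℓ¹`. -/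

section VStar

variable {X : Type*} [NormedAddCommGroup X] [NormedSpace ℝ X]

theorem WeaklyNull.map {Y : Type*} [NormedAddCommGroup Y] [NormedSpace ℝ Y] {x : ℕ → X}
    (hx : WeaklyNull x) (T : X →L[ℝ] Y) : WeaklyNull fun n => T (x n) :=
  weaklyNull_iff_forall_dual.2 fun f => weaklyNull_iff_forall_dual.1 hx (f.comp T)

theorem isDunfordPettis_lp_one {ι : Type*} (T : X →L[ℝ] lp (fun _ : ι => ℝ) 1) :
    IsDunfordPettis T := fun _ hx => (hx.map T).tendsto_norm_of_lp_one

/-- A weakly unconditionally Cauchy series in the dual defines an operator into `ℓ¹`. -/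
theorem WeaklyUnconditionallyCauchy.exists_clm_lp_one [CompleteSpace X]
    {f : ℕ → StrongDual ℝ X} (hf : WeaklyUnconditionallyCauchy f) :
    ∃ T : X →L[ℝ] lp (fun _ : ULift.{v} ℕ => ℝ) 1, ∀ x i, T x i = f i.down x := by
  have hmem : ∀ x, Memℓp (fun i : ULift.{v} ℕ => f i.down x) 1 := fun x => by
    refine memℓp_gen ?_
    have h1 : Summable fun n => |f n x| := hf (NormedSpace.inclusionInDoubleDual ℝ X x)
    simpa [Function.comp_def] using (Equiv.ulift.{v}.summable_iff (f := fun n => |f n x|)).2 h1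
  let S : X →ₗ[ℝ] lp (fun _ : ULift.{v} ℕ => ℝ) 1 :=
    { toFun := fun x => ⟨fun i => f i.down x, hmem x⟩
      map_add' := fun x y => by ext i; exact map_add (f i.down) x y
      map_smul' := fun c x => by ext i; exact map_smul (f i.down) c x }
  refine ⟨⟨S, S.continuous_of_seq_closed_graph fun x y z hx hz => ?_⟩, fun _ _ => rfl⟩
  ext i
  obtain ⟨g, hg⟩ := exists_dual_eq_coord i
  have h1 : Tendsto (fun n => f i.down (x n)) atTop (𝓝 (z i)) := by
    have := (g.continuous.tendsto z).comp hz
    simp only [Function.comp_def, hg] at this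
    exact this
  exact tendsto_nhds_unique h1 (((f i.down).continuous.tendsto y).comp hx)

/-- If the suprema do not vanish, choose witnesses `x n`. A subsequence of `T (x n)` converges in
norm to some `y`, whose coordinates tend to zero, so the chosen coordinates do too. The `ULift`
places `ℓ¹` in the universe of the target spaces. -/
theorem isVStarSet_of_forall_lp_one [CompleteSpace X] {K : Set X} (hb : Bornology.IsBounded K)
    (hK : ∀ T : X →L[ℝ] lp (fun _ : ULift.{v} ℕ => ℝ) 1, RelativelyWeaklyCompact (T '' K)) :
    IsVStarSet K := by
  refine ⟨hb, fun f hf => ENNReal.tendsto_nhds_zero.2 fun ε hε => ?_⟩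
  by_contra hnot
  obtain ⟨φ, hφ, hlt⟩ := extraction_of_frequently_atTop (not_eventually.1 hnot)
  have hex : ∀ n, ∃ x ∈ K, ε < ‖f (φ n) x‖ₑ := by
    intro n
    have := not_le.1 (hlt n)
    simpa only [lt_iSup_iff, exists_prop] using this
  choose x hxK hx using hex
  obtain ⟨T, hT⟩ := hf.exists_clm_lp_one.{v}
  obtain ⟨y, ψ, hψ, hlim⟩ := (hK T).exists_subseq_of_lp_one (x := fun n => T (x n))
    fun n => ⟨x n, hxK n, rfl⟩
  have hy : Tendsto (fun n => ‖y ⟨φ (ψ n)⟩‖) atTop (𝓝 0) := by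
    have h1 : Summable fun n : ℕ => ‖y ⟨n⟩‖ :=
      (Equiv.ulift.{v}.symm.summable_iff (f := fun i => ‖y i‖)).2 (summable_norm_of_lp_one y)
    exact h1.tendsto_atTop_zero.comp (hφ.comp hψ).tendsto_atTop
  have hz : Tendsto (fun n => f (φ (ψ n)) (x (ψ n))) atTop (𝓝 0) := by
    refine squeeze_zero_norm (fun n => ?_) (by simpa only [add_zero] using hlim.add hy)
    rw [← hT (x (ψ n)) ⟨φ (ψ n)⟩]
    calc ‖T (x (ψ n)) ⟨φ (ψ n)⟩‖
        = ‖(T (x (ψ n)) - y) ⟨φ (ψ n)⟩ + y ⟨φ (ψ n)⟩‖ := by simp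
      _ ≤ ‖(T (x (ψ n)) - y) ⟨φ (ψ n)⟩‖ + ‖y ⟨φ (ψ n)⟩‖ := norm_add_le _ _
      _ ≤ ‖T (x (ψ n)) - y‖ + ‖y ⟨φ (ψ n)⟩‖ :=
          add_le_add (lp.norm_apply_le_norm one_ne_zero _ _) le_rfl
  have hz' := tendsto_zero_iff_enorm_tendsto_zero.1 hz
  obtain ⟨n, hn⟩ := (hz'.eventually_le_const hε).exists
  exact (hx (ψ n)).not_ge hn

end VStar

section DunfordPettis

variable {E : Type*} [NormedAddCommGroup E] [NormedSpace ℝ E] [Lattice E]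

theorem IsDunfordPettis.isAlmostDunfordPettis {Y : Type*} [NormedAddCommGroup Y] [NormedSpace ℝ Y]
    {T : E →L[ℝ] Y} (hT : IsDunfordPettis T) : IsAlmostDunfordPettis T :=
  fun x _ hx => hT x hx

end DunfordPettis

end BanachLatticeSets

theorem proposition1 {E : Type u} [NormedAddCommGroup E] [NormedSpace ℝ E] [CompleteSpace E]
    [Lattice E] [IsOrderedAddMonoid E] [IsOrderedModule ℝ E] [HasSolidNorm E]
    (K : Set E) (hK : Bornology.IsBounded K) :
    List.TFAE
      [BanachLatticeSets.IsReciprocalDunfordPettisSet.{u, v} K,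
       BanachLatticeSets.IsVStarSet K,
       BanachLatticeSets.IsDisjointlyWeaklyCompact K,
       ∀ (X : Type w) [NormedAddCommGroup X] [NormedSpace ℝ X] [CompleteSpace X] (T : E →L[ℝ] X),
         BanachLatticeSets.IsAlmostDunfordPettis T →
           BanachLatticeSets.RelativelyWeaklyCompact (T '' K)] := by
  tfae_have 1 → 2 := fun h => BanachLatticeSets.isVStarSet_of_forall_lp_one.{v} hK fun T =>
    h.2 _ T (BanachLatticeSets.isDunfordPettis_lp_one T)
  tfae_have 2 → 3 := fun h => h.isDisjointlyWeaklyCompact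
  tfae_have 3 → 4 := fun h _ _ _ _ _ hT => h.relativelyWeaklyCompact_image hT
  tfae_have 3 → 1 := fun h => ⟨hK, fun _ _ _ _ _ hT =>
    h.relativelyWeaklyCompact_image hT.isAlmostDunfordPettis⟩
  tfae_have 4 → 2 := fun h => BanachLatticeSets.isVStarSet_of_forall_lp_one.{w} hK fun T =>
    h _ T (BanachLatticeSets.isDunfordPettis_lp_one T).isAlmostDunfordPettis
  tfae_finish
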